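/- Let $X$ be a locally compact $CAT(0)$-space (by definition complete). A geodesic is a locally distance-preserving map of an interval into $X$; a complete geodesic is one defined on $\mathbb R$. Let $\partial_\infty X$ be the set of classes of asymptotic geodesic rays (rays at finite Hausdorff distance from each other), equipped with the cone topology, that is, the topology generated by the sets $\{\eta : |c_\xi(K)c_\eta(K)|<\delta\}$, where $x_0\in X$, $\xi\in\partial_\infty X$, $K,\delta>0$, and $c_\xi,c_\eta$ are the rays from $x_0$ to $\xi,\eta$. Two complete geodesics are called asymptotic if they have a common endpoint in $\partial_\infty X$. A complete geodesic $c$ is of strictly rank one if there is no finite sequence $c=c_0,c_1,\dots,c_n$ ($n\ge 0$) of complete geodesics such that $c_{i-1}$ and $c_i$ are asymptotic for $1\le i\le n$ and $c_n$ is a boundary line of a flat strip, i.e. of a subset of $X$ isometric to a Euclidean strip $\mathbb R\times[0,w]$ with $w>0$. Let $d\colon\mathbb R\to X$ be a complete geodesic of strictly rank one, let $x\in X$ be a point not on $d$, and let $x_1$ be its projection onto $d$ (the point of $d$ nearest to $x$). Then for every $\varepsilon>0$ there are neighbourhoods $\mathcal U_+$ of $d(+\infty)$ and $\mathcal U_-$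 of $d(-\infty)$ in $\partial_\infty X$ such that 1. any $\xi\in\mathcal U_+$ and $\eta\in\mathcal U_-$ are joined by a complete geodesic $d'$ with $d'(+\infty)=\xi$ and $d'(-\infty)=\eta$; and 2. for every complete geodesic $d'$ with $d'(+\infty)\in\mathcal U_+$ and $d'(-\infty)\in\mathcal U_-$, the projection $x_1'$ of $x$ onto $d'$ satisfies $|x_1x_1'|<\varepsilon$. -/

import Mathlib

open Set Topology

/-- A geodesic on an interval `I ⊆ ℝ`: a map that preserves distances near each point of `I`.
Only the values of `c` on `I` matter. -/
def IsGeodesicOn {X : Type*} [MetricSpace X] (c : ℝ → X) (I : Set ℝ) : Prop :=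
  ∀ t ∈ I, ∃ U ∈ 𝓝[I] t, ∀ s₁ ∈ U ∩ I, ∀ s₂ ∈ U ∩ I, dist (c s₁) (c s₂) = |s₁ - s₂|

/-- `c`, restricted to `[0, |xy|]`, is a minimizing segment that runs from `x` to `y`. -/
structure IsMinimizingSegment {X : Type*} [MetricSpace X] (c : ℝ → X) (x y : X) : Prop where
  start : c 0 = x
  finish : c (dist x y) = y
  dist_eq : ∀ s ∈ Icc 0 (dist x y), ∀ t ∈ Icc 0 (dist x y), dist (c s) (c t) = |s - t|

/-- `CAT(0)`-spaces: complete geodesic metric spaces in which triangles are not thicker than their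
comparison triangles in the Euclidean plane. For two points on one side of a triangle the comparison
inequality is an equality, and two different sides share a vertex, called `x` here, so the inequality
is required for a point `c s` of the side `xy` and a point `c' t` of the side `xz`. -/
structure IsCAT0 (X : Type*) [MetricSpace X] : Prop where
  complete : CompleteSpace X
  exists_segment : ∀ x y : X, ∃ c : ℝ → X, IsMinimizingSegment c x y
  comparison : ∀ (x y z : X) (c c' : ℝ → X),
    IsMinimizingSegment c x y → IsMinimizingSegment c' x z →
    ∀ x' y' z' : EuclideanSpace ℝ (Fin 2),
      dist x' y' = dist x y → dist y' z' = dist y z → dist x' z' = dist x z →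
    ∀ s ∈ Icc 0 (dist x y), ∀ t ∈ Icc 0 (dist x z),
    ∀ p ∈ segment ℝ x' y', ∀ q ∈ segment ℝ x' z', dist x' p = s → dist x' q = t →
      dist (c s) (c' t) ≤ dist p q

/-- Geodesic rays `[0, ∞) → X`; values at negative numbers are irrelevant. -/
def GeodesicRay (X : Type*) [MetricSpace X] : Type _ :=
  {c : ℝ → X // IsGeodesicOn c (Ici 0)}

/-- Two rays are asymptotic if the Hausdorff distance of their images is finite. -/
def GeodesicRay.Asymptotic {X : Type*} [MetricSpace X] (c₁ c₂ : GeodesicRay X) : Prop :=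
  Metric.hausdorffEDist (c₁.1 '' Ici 0) (c₂.1 '' Ici 0) ≠ ⊤

/-- The asymptoticity equivalence relation on rays. -/
def asymptoticSetoid (X : Type*) [MetricSpace X] : Setoid (GeodesicRay X) where
  r := GeodesicRay.Asymptotic
  iseqv :=
    { refl := fun c => by simp [GeodesicRay.Asymptotic]
      symm := fun {c₁ c₂} h => by
        unfold GeodesicRay.Asymptotic at *
        rwa [Metric.hausdorffEDist_comm]
      trans := fun {c₁ c₂ c₃} h₁ h₂ =>
        ne_top_of_le_ne_top (ENNReal.add_ne_top.2 ⟨h₁, h₂⟩) Metric.hausdorffEDist_triangle }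

/-- The boundary at infinity: classes of asymptotic rays. -/
def IdealBoundary (X : Type*) [MetricSpace X] : Type _ := Quotient (asymptoticSetoid X)

/-- The ideal point of a ray. -/
def GeodesicRay.endpoint {X : Type*} [MetricSpace X] (c : GeodesicRay X) : IdealBoundary X :=
  Quotient.mk (asymptoticSetoid X) c

/-- The set of ideal points `η` such that the rays from `x₀` to `ξ` and from `x₀` to `η` are at
distance less than `δ` from each other at time `K`. -/
def coneNhd {X : Type*} [MetricSpace X] (ξ : IdealBoundary X) (x₀ : X) (K δ : ℝ) :
    Set (IdealBoundary X) :=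
  {η | ∃ c c' : GeodesicRay X, c.1 0 = x₀ ∧ c.endpoint = ξ ∧ c'.1 0 = x₀ ∧ c'.endpoint = η ∧
    dist (c.1 K) (c'.1 K) < δ}

/-- The cone topology on the boundary at infinity. -/
instance IdealBoundary.coneTopology (X : Type*) [MetricSpace X] :
    TopologicalSpace (IdealBoundary X) :=
  TopologicalSpace.generateFrom
    {U | ∃ (ξ : IdealBoundary X) (x₀ : X) (K δ : ℝ), 0 < K ∧ 0 < δ ∧ U = coneNhd ξ x₀ K δ}

/-- Complete geodesics `ℝ → X`. -/
def GeodesicLine (X : Type*) [MetricSpace X] : Type _ :=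
  {c : ℝ → X // IsGeodesicOn c univ}

namespace GeodesicLine

/-- The ray `t ↦ c t`, `t ≥ 0`. -/
def posRay {X : Type*} [MetricSpace X] (c : GeodesicLine X) : GeodesicRay X :=
  ⟨c.1, fun t _ => by
    obtain ⟨U, hU, h⟩ := c.2 t (mem_univ t)
    refine ⟨U, nhdsWithin_mono t (subset_univ _) hU, fun s₁ h₁ s₂ h₂ => ?_⟩
    exact h s₁ ⟨h₁.1, mem_univ _⟩ s₂ ⟨h₂.1, mem_univ _⟩⟩

/-- The ray `t ↦ c (-t)`, `t ≥ 0`. -/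
def negRay {X : Type*} [MetricSpace X] (c : GeodesicLine X) : GeodesicRay X :=
  ⟨fun t => c.1 (-t), fun t _ => by
    obtain ⟨U, hU, h⟩ := c.2 (-t) (mem_univ _)
    rw [nhdsWithin_univ] at hU
    refine ⟨(fun s => -s) ⁻¹' U,
      mem_nhdsWithin_of_mem_nhds (continuous_neg.continuousAt.preimage_mem_nhds hU),
      fun s₁ h₁ s₂ h₂ => ?_⟩
    rw [h (-s₁) ⟨h₁.1, mem_univ _⟩ (-s₂) ⟨h₂.1, mem_univ _⟩, neg_sub_neg, abs_sub_comm]⟩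

/-- The ideal point `c(+∞)`. -/
def posEnd {X : Type*} [MetricSpace X] (c : GeodesicLine X) : IdealBoundary X :=
  c.posRay.endpoint

/-- The ideal point `c(-∞)`. -/
def negEnd {X : Type*} [MetricSpace X] (c : GeodesicLine X) : IdealBoundary X :=
  c.negRay.endpoint

/-- Complete geodesics are asymptotic if some ray of the first, in one of its two directions, is
asymptotic to some ray of the second. -/
def Asymptotic {X : Type*} [MetricSpace X] (c₁ c₂ : GeodesicLine X) : Prop :=
  (({c₁.posEnd, c₁.negEnd} : Set (IdealBoundary X)) ∩ {c₂.posEnd, c₂.negEnd}).Nonempty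

/-- `c` is a boundary geodesic of a flat strip, that is, of an isometric copy in `X` of a strip
`ℝ × [0, w]`, `w > 0`, of the Euclidean plane. -/
def BoundsFlatStrip {X : Type*} [MetricSpace X] (c : GeodesicLine X) : Prop :=
  ∃ w : ℝ, 0 < w ∧ ∃ f : EuclideanSpace ℝ (Fin 2) → X,
    (∀ p q : EuclideanSpace ℝ (Fin 2), p 1 ∈ Icc 0 w → q 1 ∈ Icc 0 w →
      dist (f p) (f q) = dist p q) ∧
    ∀ t : ℝ, f !₂[t, 0] = c.1 t

/-- A finite (possibly trivial) chain of consecutively asymptotic geodesics leads from `c` to a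
geodesic that bounds a flat strip. -/
def VirtuallyBoundsFlatStrip {X : Type*} [MetricSpace X] (c : GeodesicLine X) : Prop :=
  ∃ c' : GeodesicLine X, Relation.ReflTransGen Asymptotic c c' ∧ c'.BoundsFlatStrip

/-- Geodesics of strictly rank one. -/
def IsStrictlyRankOne {X : Type*} [MetricSpace X] (c : GeodesicLine X) : Prop :=
  ¬ c.VirtuallyBoundsFlatStrip

/-- `x₁` is a projection of `x` onto the geodesic `c`: a point of `c` nearest to `x`. -/
def IsProjection {X : Type*} [MetricSpace X] (c : GeodesicLine X) (x x₁ : X) : Prop :=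
  x₁ ∈ range c.1 ∧ ∀ y ∈ range c.1, dist x x₁ ≤ dist x y

end GeodesicLine

/-! Strict rank one enters through the trivial chain: `d` itself bounds no flat strip. The heart is
`GeodesicLine.exists_segment_near`: a segment whose ends lie far out, roughly in the directions
`d(-∞)` and `d(+∞)` as seen from `d s`, passes close to `d s`. Otherwise, pull the ends of bad
segments back towards `d s` until the segments just miss a fixed ball about `d s`. These segments
stay near that ball and subconverge to a line that is parallel to `d` but avoids `d s`, so the flat
strip theorem gives a strip along `d`.

For ideal points in small cone neighbourhoods, the segments between far points of representing rays
therefore pass near `d s`. A limit of such segments is a line joining the ideal points. If the rays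
are the halves of a given line `d'`, the segments lie on `d'`, so `d'` passes near `d s`. Use this
at two points of `d` far out on either side of `x₁`: by convexity `d'` stays near `d` in between,
and `GeodesicLine.dist_projection_le` compares the projections. -/

theorem exists_comparison_vectors {a b e : ℝ} (ha : 0 ≤ a) (hb : 0 ≤ b) (he : 0 ≤ e)
    (h₁ : a ≤ b + e) (h₂ : b ≤ a + e) (h₃ : e ≤ a + b) :
    ∃ y z : EuclideanSpace ℝ (Fin 2), ‖y‖ = a ∧ ‖z‖ = b ∧ ‖y - z‖ = e := by
  rcases ha.eq_or_lt with rfl | ha'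
  · have : e = b := by linarith
    subst this
    refine ⟨0, !₂[e, 0], by simp, ?_, ?_⟩ <;> simp [EuclideanSpace.norm_eq, Real.sqrt_sq he]
  · set m := (a ^ 2 + b ^ 2 - e ^ 2) / (2 * a) with hm
    have hma : 2 * a * m = a ^ 2 + b ^ 2 - e ^ 2 := by rw [hm]; field_simp
    have hmb : m ^ 2 ≤ b ^ 2 := by
      -- Heron's product, 16 times the squared area; it equals `4a²(b² - m²)`.
      have h4 : 0 ≤ ((a + b) ^ 2 - e ^ 2) * (e ^ 2 - (a - b) ^ 2) := by
        apply mul_nonneg <;> nlinarith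
      have h5 : (2 * a) ^ 2 * m ^ 2 ≤ (2 * a) ^ 2 * b ^ 2 := by
        rw [← mul_pow, hma]; nlinarith
      exact le_of_mul_le_mul_left h5 (by positivity)
    have hs := Real.sq_sqrt (sub_nonneg.2 hmb)
    refine ⟨!₂[a, 0], !₂[m, √(b ^ 2 - m ^ 2)], ?_, ?_, ?_⟩
    · simp [EuclideanSpace.norm_eq, Real.sqrt_sq ha]
    · simp [EuclideanSpace.norm_eq, hs, Real.sqrt_sq hb]
    · have : (a - m) ^ 2 + (b ^ 2 - m ^ 2) = e ^ 2 := by nlinarith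
      simp [EuclideanSpace.norm_eq, hs, this, Real.sqrt_sq he]

/-! ### Segments and comparison inequalities -/

namespace IsCAT0

variable {X : Type*} [MetricSpace X] (hX : IsCAT0 X)

/-- The point at distance `t` from `x` on the segment from `x` to `y`; the parameter is clamped
to `[0, |xy|]`. -/
noncomputable def pt (x y : X) (t : ℝ) : X :=
  (hX.exists_segment x y).choose (max 0 (min t (dist x y)))

/-- The point that divides the segment from `x` to `y` in the ratio `u : 1 - u`. -/
noncomputable def frac (x y : X) (u : ℝ) : X := hX.pt x y (u * dist x y)

theorem pt_spec (x y : X) {t : ℝ} (h₀ : 0 ≤ t) (h₁ : t ≤ dist x y) :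
    hX.pt x y t = (hX.exists_segment x y).choose t := by
  simp [pt, h₀, h₁]

@[simp] theorem pt_zero (x y : X) : hX.pt x y 0 = x := by
  rw [pt_spec _ _ _ le_rfl dist_nonneg, (hX.exists_segment x y).choose_spec.start]

theorem pt_of_le (x y : X) {t : ℝ} (h : dist x y ≤ t) : hX.pt x y t = y := by
  simp [pt, h, (hX.exists_segment x y).choose_spec.finish]

theorem dist_pt_pt (x y : X) {s t : ℝ} (hs : s ∈ Icc 0 (dist x y)) (ht : t ∈ Icc 0 (dist x y)) :
    dist (hX.pt x y s) (hX.pt x y t) = |s - t| := by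
  rw [pt_spec _ _ _ hs.1 hs.2, pt_spec _ _ _ ht.1 ht.2]
  exact (hX.exists_segment x y).choose_spec.dist_eq s hs t ht

theorem dist_pt_pt_le (x y : X) (s t : ℝ) : dist (hX.pt x y s) (hX.pt x y t) ≤ |s - t| := by
  unfold pt
  rw [(hX.exists_segment x y).choose_spec.dist_eq _
    ⟨le_max_left _ _, max_le dist_nonneg (min_le_right _ _)⟩ _
    ⟨le_max_left _ _, max_le dist_nonneg (min_le_right _ _)⟩]
  refine (abs_max_sub_max_le_max _ _ _ _).trans ?_
  simp only [sub_self, abs_zero, abs_nonneg, max_eq_right]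
  refine (abs_min_sub_min_le_max _ _ _ _).trans ?_
  simp

theorem dist_left_pt (x y : X) {t : ℝ} (ht : t ∈ Icc 0 (dist x y)) :
    dist x (hX.pt x y t) = t := by
  have := hX.dist_pt_pt x y ⟨le_rfl, dist_nonneg⟩ ht
  rwa [pt_zero, zero_sub, abs_neg, abs_of_nonneg ht.1] at this

theorem dist_pt_right (x y : X) {t : ℝ} (ht : t ∈ Icc 0 (dist x y)) :
    dist (hX.pt x y t) y = dist x y - t := by
  have := hX.dist_pt_pt x y ht ⟨dist_nonneg, le_rfl⟩
  rwa [pt_of_le _ _ _ le_rfl, abs_sub_comm, abs_of_nonneg (sub_nonneg.2 ht.2)] at this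

theorem mul_dist_mem {x y : X} {u : ℝ} (hu : u ∈ Icc (0 : ℝ) 1) :
    u * dist x y ∈ Icc 0 (dist x y) :=
  ⟨mul_nonneg hu.1 dist_nonneg, mul_le_of_le_one_left dist_nonneg hu.2⟩

@[simp] theorem frac_zero (x y : X) : hX.frac x y 0 = x := by simp [frac]

@[simp] theorem frac_one (x y : X) : hX.frac x y 1 = y := by simp [frac, pt_of_le]

theorem dist_frac_frac (x y : X) {u v : ℝ} (hu : u ∈ Icc (0 : ℝ) 1) (hv : v ∈ Icc (0 : ℝ) 1) :
    dist (hX.frac x y u) (hX.frac x y v) = |u - v| * dist x y := by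
  rw [frac, frac, dist_pt_pt _ _ _ (mul_dist_mem hu) (mul_dist_mem hv), ← sub_mul, abs_mul,
    abs_of_nonneg (dist_nonneg (x := x))]

theorem pt_eq_frac {x y : X} {t : ℝ} (ht : t ∈ Icc 0 (dist x y)) :
    hX.pt x y t = hX.frac x y (t / dist x y) := by
  rcases (dist_nonneg (x := x) (y := y)).eq_or_lt with h | h
  · have : t = 0 := le_antisymm (ht.2.trans h.symm.le) ht.1
    simp [this]
  · rw [frac, div_mul_cancel₀ _ h.ne']

/-- The `CAT(0)` inequality, with the law of cosines for the comparison triangle written out. -/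
theorem dist_frac_frac_sq_le (x y z : X) {u v : ℝ} (hu : u ∈ Icc (0 : ℝ) 1)
    (hv : v ∈ Icc (0 : ℝ) 1) :
    dist (hX.frac x y u) (hX.frac x z v) ^ 2 ≤
      u ^ 2 * dist x y ^ 2 + v ^ 2 * dist x z ^ 2
        - u * v * (dist x y ^ 2 + dist x z ^ 2 - dist y z ^ 2) := by
  obtain ⟨y', z', hy, hz, hyz⟩ := exists_comparison_vectors
    (a := dist x y) (b := dist x z) (e := dist y z) dist_nonneg dist_nonneg dist_nonneg
    (by have := dist_triangle x z y; rw [dist_comm z y] at this; linarith)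
    (dist_triangle x y z)
    (by have := dist_triangle y x z; rw [dist_comm y x] at this; linarith)
  have key := hX.comparison x y z _ _ (hX.exists_segment x y).choose_spec
    (hX.exists_segment x z).choose_spec 0 y' z' (by simp [hy]) (by rw [dist_eq_norm, hyz])
    (by simp [hz]) _ (mul_dist_mem hu) _ (mul_dist_mem hv) (u • y')
    ⟨1 - u, u, by linarith [hu.2], hu.1, by ring, by simp⟩ (v • z')
    ⟨1 - v, v, by linarith [hv.2], hv.1, by ring, by simp⟩
    (by rw [dist_zero_left, norm_smul, hy, Real.norm_of_nonneg hu.1])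
    (by rw [dist_zero_left, norm_smul, hz, Real.norm_of_nonneg hv.1])
  rw [← hX.pt_spec _ _ (mul_dist_mem hu).1 (mul_dist_mem hu).2,
    ← hX.pt_spec _ _ (mul_dist_mem hv).1 (mul_dist_mem hv).2] at key
  have h1 := norm_sub_sq_real (u • y') (v • z')
  have h2 := norm_sub_sq_real y' z'
  rw [real_inner_smul_left, real_inner_smul_right, norm_smul, norm_smul, mul_pow, mul_pow, hy, hz,
    Real.norm_of_nonneg hu.1, Real.norm_of_nonneg hv.1] at h1
  rw [hy, hz, hyz] at h2
  calc _ ≤ dist (u • y') (v • z') ^ 2 := pow_le_pow_left₀ dist_nonneg key 2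
    _ = _ := by rw [dist_eq_norm, h1, h2]; ring

theorem dist_frac_sq_le (x y z : X) {u : ℝ} (hu : u ∈ Icc (0 : ℝ) 1) :
    dist z (hX.frac x y u) ^ 2 ≤
      (1 - u) * dist z x ^ 2 + u * dist z y ^ 2 - u * (1 - u) * dist x y ^ 2 := by
  have := hX.dist_frac_frac_sq_le x y z hu (v := 1) ⟨zero_le_one, le_rfl⟩
  rw [frac_one] at this
  rw [dist_comm z, dist_comm z x, dist_comm z y]
  linarith

/-- The comparison triangle of `x, y, p` is degenerate, which makes the bound on the squared
distance zero. This is uniqueness of segments. -/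
theorem eq_frac {x y p : X} {u : ℝ} (hu : u ∈ Icc (0 : ℝ) 1) (h₁ : dist x p = u * dist x y)
    (h₂ : dist p y = (1 - u) * dist x y) : p = hX.frac x y u := by
  have := hX.dist_frac_sq_le x y p hu
  rw [dist_comm p x, h₁, h₂] at this
  have h0 : dist p (hX.frac x y u) ^ 2 ≤ 0 := this.trans (by apply le_of_eq; ring)
  exact dist_eq_zero.1 (pow_eq_zero_iff two_ne_zero |>.1 (le_antisymm h0 (sq_nonneg _)))

theorem eq_pt {x y p : X} {t : ℝ} (h₁ : dist x p = t) (h₂ : dist p y = dist x y - t) :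
    p = hX.pt x y t := by
  have ht : t ∈ Icc 0 (dist x y) :=
    ⟨h₁ ▸ dist_nonneg, by linarith [dist_nonneg (x := p) (y := y)]⟩
  rw [hX.pt_eq_frac ht]
  rcases (dist_nonneg (x := x) (y := y)).eq_or_lt with h | h
  · have h0 : t = 0 := le_antisymm (ht.2.trans h.symm.le) ht.1
    rw [h0, zero_div, frac_zero]
    exact (dist_eq_zero.1 (h₁.trans h0)).symm
  · apply hX.eq_frac ⟨div_nonneg ht.1 h.le, div_le_one_of_le₀ ht.2 h.le⟩
    · rw [h₁]; field_simp
    · rw [h₂]; field_simp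

theorem pt_symm {x y : X} {t : ℝ} (ht : t ∈ Icc 0 (dist x y)) :
    hX.pt y x (dist x y - t) = hX.pt x y t := by
  have h : dist x y - t ∈ Icc 0 (dist y x) := by
    rw [dist_comm y x]; exact ⟨sub_nonneg.2 ht.2, by linarith [ht.1]⟩
  apply hX.eq_pt
  · rw [dist_comm, dist_pt_right _ _ _ h, dist_comm y x]; ring
  · rw [dist_comm, dist_left_pt _ _ _ h]

theorem frac_symm (x y : X) {u : ℝ} (hu : u ∈ Icc (0 : ℝ) 1) :
    hX.frac y x (1 - u) = hX.frac x y u := by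
  rw [frac, frac, ← hX.pt_symm (mul_dist_mem hu), dist_comm y x]
  congr 1; ring

theorem pt_pt (x y : X) {s t : ℝ} (hs : 0 ≤ s) (hst : s ≤ t) (ht : t ≤ dist x y) :
    hX.pt x (hX.pt x y t) s = hX.pt x y s := by
  symm
  have ht' : t ∈ Icc 0 (dist x y) := ⟨hs.trans hst, ht⟩
  have hs' : s ∈ Icc 0 (dist x y) := ⟨hs, hst.trans ht⟩
  apply hX.eq_pt (hX.dist_left_pt x y hs')
  rw [hX.dist_pt_pt x y hs' ht', hX.dist_left_pt x y ht', abs_sub_comm,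
    abs_of_nonneg (sub_nonneg.2 hst)]

theorem dist_frac_frac_le_mul (x y z : X) {u : ℝ} (hu : u ∈ Icc (0 : ℝ) 1) :
    dist (hX.frac x y u) (hX.frac x z u) ≤ u * dist y z := by
  refine le_of_sq_le_sq ?_ (mul_nonneg hu.1 dist_nonneg)
  linarith [hX.dist_frac_frac_sq_le x y z hu hu]

/-- Convexity of the metric. -/
theorem dist_frac_frac_le (x y x' y' : X) {u : ℝ} (hu : u ∈ Icc (0 : ℝ) 1) :
    dist (hX.frac x y u) (hX.frac x' y' u) ≤ (1 - u) * dist x x' + u * dist y y' := by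
  have hu' : 1 - u ∈ Icc (0 : ℝ) 1 := ⟨by linarith [hu.2], by linarith [hu.1]⟩
  have h1 := hX.dist_frac_frac_le_mul x y y' hu
  have h2 := hX.dist_frac_frac_le_mul y' x x' hu'
  rw [hX.frac_symm x y' hu, hX.frac_symm x' y' hu] at h2
  linarith [dist_triangle (hX.frac x y u) (hX.frac x y' u) (hX.frac x' y' u)]

/-- Monotonicity of angles with the denominators cleared: the comparison angle at `x` does not grow
when the two sides are shortened. -/
theorem dist_pt_pt_sq_le (x y z : X) {s t : ℝ} (hs : s ∈ Icc 0 (dist x y))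
    (ht : t ∈ Icc 0 (dist x z)) (hy : 0 < dist x y) (hz : 0 < dist x z) :
    dist x y * dist x z * dist (hX.pt x y s) (hX.pt x z t) ^ 2 ≤
      dist x y * dist x z * (s ^ 2 + t ^ 2)
        - s * t * (dist x y ^ 2 + dist x z ^ 2 - dist y z ^ 2) := by
  rw [hX.pt_eq_frac hs, hX.pt_eq_frac ht]
  have := hX.dist_frac_frac_sq_le x y z (u := s / dist x y) (v := t / dist x z)
    ⟨div_nonneg hs.1 hy.le, div_le_one_of_le₀ hs.2 hy.le⟩
    ⟨div_nonneg ht.1 hz.le, div_le_one_of_le₀ ht.2 hz.le⟩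
  calc _ ≤ _ := mul_le_mul_of_nonneg_left this (mul_pos hy hz).le
    _ = _ := by field_simp

theorem dist_pt_pt_le_mul (x y z : X) {r K : ℝ} (hr : 0 ≤ r) (hrK : r ≤ K) (hK : 0 < K)
    (hy : K ≤ dist x y) (hz : K ≤ dist x z) :
    dist (hX.pt x y r) (hX.pt x z r) ≤ r / K * dist y z := by
  have h := hX.dist_pt_pt_sq_le x y z ⟨hr, hrK.trans hy⟩ ⟨hr, hrK.trans hz⟩ (hK.trans_le hy)
    (hK.trans_le hz)
  refine le_of_sq_le_sq ?_ (by positivity)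
  set a := dist x y
  set b := dist x z
  set e := dist y z
  set q := dist (hX.pt x y r) (hX.pt x z r)
  have hab : K * K ≤ a * b := mul_le_mul hy hz hK.le (hK.le.trans hy)
  -- For equal parameters `h` reads `a b q² ≤ r² (e² - (a - b)²)`.
  have h1 : K * K * q ^ 2 ≤ r ^ 2 * e ^ 2 := by
    have : K * K * q ^ 2 ≤ a * b * q ^ 2 := mul_le_mul_of_nonneg_right hab (sq_nonneg _)
    nlinarith [mul_nonneg (sq_nonneg r) (sq_nonneg (a - b))]
  rw [mul_pow, div_pow, div_mul_eq_mul_div, le_div_iff₀ (by positivity)]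
  linarith

theorem dist_pt_pt_le_dist_aux (x y z : X) {r : ℝ} (hr : 0 ≤ r) (hyz : dist x y ≤ dist x z) :
    dist (hX.pt x y r) (hX.pt x z r) ≤ dist y z := by
  rcases le_or_gt r (dist x y) with h | h
  · rcases hr.eq_or_lt with rfl | hr
    · simp
    · simpa [hr.ne'] using hX.dist_pt_pt_le_mul x y z hr.le le_rfl hr h (h.trans hyz)
  · rw [hX.pt_of_le x y h.le]
    rcases le_or_gt (dist x z) r with h' | h'
    · rw [hX.pt_of_le x z h']
    · have := hX.dist_frac_sq_le x z y (u := r / dist x z)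
        ⟨by positivity, div_le_one_of_le₀ h'.le dist_nonneg⟩
      rw [← hX.pt_eq_frac ⟨hr, h'.le⟩] at this
      refine le_of_sq_le_sq (this.trans ?_) dist_nonneg
      have hz : 0 < dist x z := hr.trans_lt h'
      rw [dist_comm y x]
      set u := r / dist x z with hu
      have hru : r = u * dist x z := by rw [hu]; field_simp
      have hu1 : u ≤ 1 := div_le_one_of_le₀ h'.le dist_nonneg
      -- Here `y` is inside the ball of radius `r` and `z` outside. The inequality makes the terms
      -- with `|xy|²` and `|xz|²` contribute at most zero, leaving `u |yz|²`.
      have : dist x y ^ 2 ≤ u * dist x z ^ 2 := by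
        rw [hru] at h
        nlinarith [dist_nonneg (x := x) (y := y)]
      nlinarith

/-- Moving two points towards `x` until they are at distance at most `r` from it does not
increase their distance. -/
theorem dist_pt_pt_le_dist (x y z : X) {r : ℝ} (hr : 0 ≤ r) :
    dist (hX.pt x y r) (hX.pt x z r) ≤ dist y z := by
  rcases le_total (dist x y) (dist x z) with h | h
  · exact hX.dist_pt_pt_le_dist_aux x y z hr h
  · rw [dist_comm, dist_comm y]
    exact hX.dist_pt_pt_le_dist_aux x z y hr h

end IsCAT0

/-! ### Properness -/

section Hopf

theorem IsCAT0.exists_dist_le {X : Type*} [MetricSpace X] (hX : IsCAT0 X) {x y : X} {r ε : ℝ}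
    (hr : 0 ≤ r) (hε : 0 ≤ ε) (h : dist x y ≤ r + ε) :
    ∃ z, dist x z ≤ r ∧ dist y z ≤ ε := by
  rcases le_or_gt (dist x y) r with h' | h'
  · exact ⟨y, h', by simpa⟩
  · refine ⟨hX.pt x y r, (hX.dist_left_pt x y ⟨hr, h'.le⟩).le, ?_⟩
    rw [dist_comm, hX.dist_pt_right x y ⟨hr, h'.le⟩]
    linarith

/-- Hopf–Rinow. -/
theorem IsCAT0.properSpace {X : Type*} [MetricSpace X] [LocallyCompactSpace X] (hX : IsCAT0 X) :
    ProperSpace X := by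
  have := hX.complete
  refine ⟨fun x => ?_⟩
  -- If `S` were bounded, the ball of radius `sSup S` would be totally bounded, since smaller
  -- compact balls approximate it. A compact neighbourhood of it would then contain a larger ball.
  set S : Set ℝ := {r | 0 ≤ r ∧ IsCompact (Metric.closedBall x r)}
  have h0 : (0 : ℝ) ∈ S := ⟨le_rfl, by simp⟩
  have hmono : ∀ r r', r' ∈ S → r ≤ r' → IsCompact (Metric.closedBall x r) := fun r r' h hr =>
    h.2.of_isClosed_subset Metric.isClosed_closedBall (Metric.closedBall_subset_closedBall hr)
  by_cases hS : BddAbove S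
  · exfalso
    have hR0 : 0 ≤ sSup S := le_csSup hS h0
    have hR : IsCompact (Metric.closedBall x (sSup S)) := by
      refine TotallyBounded.isCompact_of_isClosed ?_ Metric.isClosed_closedBall
      rw [Metric.totallyBounded_iff]
      intro ε hε
      have hlt : sSup S - ε / 4 < sSup S := by linarith
      obtain ⟨r, hrS, hr⟩ := exists_lt_of_lt_csSup ⟨0, h0⟩ hlt
      obtain ⟨t, ht, htc⟩ := Metric.totallyBounded_iff.1 hrS.2.totallyBounded (ε / 2) (by positivity)
      refine ⟨t, ht, fun y hy => ?_⟩
      obtain ⟨z, hz, hyz⟩ := hX.exists_dist_le (x := x) (y := y) hrS.1 (ε := ε / 4) (by positivity)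
        (by rw [Metric.mem_closedBall, dist_comm] at hy; linarith)
      have := htc (Metric.mem_closedBall'.2 hz)
      simp only [mem_iUnion, Metric.mem_ball] at this ⊢
      obtain ⟨i, hi, hzi⟩ := this
      exact ⟨i, hi, by linarith [dist_triangle y z i]⟩
    obtain ⟨K, hK, hsub⟩ := exists_compact_superset hR
    obtain ⟨δ, hδ, hδK⟩ := hR.exists_cthickening_subset_open isOpen_interior hsub
    have : sSup S + δ ∈ S := by
      refine ⟨by linarith, hK.of_isClosed_subset Metric.isClosed_closedBall fun y hy => ?_⟩
      obtain ⟨z, hz, hyz⟩ := hX.exists_dist_le (x := x) (y := y) hR0 hδ.le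
        (by rwa [Metric.mem_closedBall, dist_comm] at hy)
      exact interior_subset (hδK (Metric.mem_cthickening_of_dist_le y z δ _
        (Metric.mem_closedBall'.2 hz) hyz))
    linarith [le_csSup hS this]
  · intro r
    rw [not_bddAbove_iff] at hS
    obtain ⟨r', hr', h⟩ := hS r
    exact hmono r r' hr' h.le

end Hopf

/-! ### Local geodesics are minimizing; asymptotic rays -/

section LocalGlobal

variable {X : Type*} [MetricSpace X]

/-- A map that preserves distances on `I`. -/
def IsometricOn (c : ℝ → X) (I : Set ℝ) : Prop :=
  ∀ s ∈ I, ∀ t ∈ I, dist (c s) (c t) = |s - t|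

theorem isometricOn_of_le {c : ℝ → X} {I : Set ℝ}
    (h : ∀ s ∈ I, ∀ t ∈ I, s < t → dist (c s) (c t) = t - s) : IsometricOn c I := by
  intro s hs t ht
  rcases lt_trichotomy s t with hst | rfl | hst
  · rw [h s hs t ht hst, abs_sub_comm, abs_of_pos (sub_pos.2 hst)]
  · simp
  · rw [dist_comm, h t ht s hs hst, abs_of_pos (sub_pos.2 hst)]

theorem IsometricOn.dist_of_le {c : ℝ → X} {I : Set ℝ} (h : IsometricOn c I) {s t : ℝ}
    (hs : s ∈ I) (ht : t ∈ I) (hst : s ≤ t) : dist (c s) (c t) = t - s := by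
  rw [h s hs t ht, abs_sub_comm, abs_of_nonneg (sub_nonneg.2 hst)]

theorem IsometricOn.mono {c : ℝ → X} {I J : Set ℝ} (h : IsometricOn c I) (hJ : J ⊆ I) :
    IsometricOn c J := fun s hs t ht => h s (hJ hs) t (hJ ht)

theorem IsometricOn.pt_eq (hX : IsCAT0 X) {c : ℝ → X} {s t r : ℝ} (h : IsometricOn c (uIcc s t))
    (hr : r ∈ uIcc s t) : hX.pt (c s) (c t) |r - s| = c r := by
  symm
  apply hX.eq_pt
  · rw [h s left_mem_uIcc r hr, abs_sub_comm]
  · rw [h r hr t right_mem_uIcc, h s left_mem_uIcc t right_mem_uIcc]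
    rcases le_total s t with hst | hst
    · rw [uIcc_of_le hst] at hr
      rw [abs_of_nonpos (by linarith [hr.2] : r - t ≤ 0), abs_of_nonpos (by linarith : s - t ≤ 0),
        abs_of_nonneg (by linarith [hr.1] : 0 ≤ r - s)]
      ring
    · rw [uIcc_of_ge hst] at hr
      rw [abs_of_nonneg (by linarith [hr.1] : 0 ≤ r - t), abs_of_nonneg (by linarith : 0 ≤ s - t),
        abs_of_nonpos (by linarith [hr.2] : r - s ≤ 0)]
      ring

/-- Close to `m` the curve is straight, so the comparison angle at `m` of `c (m - ρ)` and `c (m +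
ρ)` is π. By monotonicity it is π for `c s` and `c t` too. -/
theorem IsometricOn.glue (hX : IsCAT0 X) {c : ℝ → X} {a m r r' : ℝ} (hr : 0 < r)
    (ham : a ≤ m - r) (h₁ : IsometricOn c (Icc a m)) (h₂ : IsometricOn c (Icc (m - r) (m + r'))) :
    IsometricOn c (Icc a (m + r')) := by
  apply isometricOn_of_le
  intro s hs t ht hst
  rcases le_or_gt t m with htm | htm
  · exact h₁.dist_of_le ⟨hs.1, hst.le.trans htm⟩ ⟨ht.1, htm⟩ hst.le
  rcases le_or_gt (m - r) s with hsm | hsm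
  · exact h₂.dist_of_le ⟨hsm, hs.2⟩ ⟨hsm.trans hst.le, ht.2⟩ hst.le
  have hA : dist (c m) (c s) = m - s := by
    rw [dist_comm, h₁.dist_of_le ⟨hs.1, by linarith⟩ ⟨by linarith, le_rfl⟩ (by linarith)]
  have hB : dist (c m) (c t) = t - m :=
    h₂.dist_of_le ⟨by linarith, by linarith [ht.2]⟩ ⟨by linarith, ht.2⟩ htm.le
  set ρ := min r (t - m)
  have hρ : 0 < ρ := lt_min hr (by linarith)
  have hρr : ρ ≤ r := min_le_left _ _
  have hρt : ρ ≤ t - m := min_le_right _ _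
  have e1 : hX.pt (c m) (c s) ρ = c (m - ρ) := by
    have := IsometricOn.pt_eq hX (c := c) (s := m) (t := s) (r := m - ρ)
      (h₁.mono (by rw [uIcc_of_ge (by linarith)]; exact Icc_subset_Icc hs.1 le_rfl))
      (by rw [uIcc_of_ge (by linarith)]; constructor <;> linarith)
    rwa [abs_of_nonpos (by linarith), show -(m - ρ - m) = ρ by ring] at this
  have e2 : hX.pt (c m) (c t) ρ = c (m + ρ) := by
    have := IsometricOn.pt_eq hX (c := c) (s := m) (t := t) (r := m + ρ)
      (h₂.mono (by rw [uIcc_of_le (by linarith)]; exact Icc_subset_Icc (by linarith) ht.2))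
      (by rw [uIcc_of_le (by linarith)]; constructor <;> linarith)
    rwa [abs_of_nonneg (by linarith), show (m + ρ - m) = ρ by ring] at this
  have h := hX.dist_pt_pt_sq_le (c m) (c s) (c t) (s := ρ) (t := ρ) ⟨hρ.le, by linarith⟩
    ⟨hρ.le, by linarith⟩ (by linarith only [hA, hsm, hr]) (by linarith only [hB, htm])
  have e3 : dist (c (m - ρ)) (c (m + ρ)) = m + ρ - (m - ρ) :=
    h₂.dist_of_le ⟨by linarith, by linarith [ht.2]⟩ ⟨by linarith, by linarith [ht.2]⟩
      (by linarith)
  rw [e1, e2, e3, hA, hB] at h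
  have htri : dist (c s) (c t) ≤ (m - s) + (t - m) := by
    rw [← hA, ← hB, dist_comm (c m) (c s)]; exact dist_triangle _ _ _
  refine le_antisymm (by linarith) ?_
  refine le_of_sq_le_sq ?_ dist_nonneg
  have h3 : ρ ^ 2 * (t - s) ^ 2 ≤ ρ ^ 2 * dist (c s) (c t) ^ 2 := by nlinarith
  exact le_of_mul_le_mul_left h3 (by positivity)

/-- At the supremum `b` of the times up to which `c` is minimizing, the local isometry overlaps a
minimizing piece `[a, m]`, and gluing leads past `b`. -/
theorem IsGeodesicOn.isometricOn (hX : IsCAT0 X) {c : ℝ → X} {a : ℝ}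
    (hc : IsGeodesicOn c (Ici a)) : IsometricOn c (Ici a) := by
  set S : Set ℝ := {b | a ≤ b ∧ IsometricOn c (Icc a b)}
  have haS : a ∈ S := ⟨le_rfl, by intro s hs t ht; simp at hs ht; simp [hs, ht]⟩
  by_cases hS : BddAbove S
  · exfalso
    set b := sSup S
    have hab : a ≤ b := le_csSup hS haS
    obtain ⟨U, hU, h⟩ := hc b hab
    obtain ⟨δ, hδ, hsub⟩ := Metric.mem_nhdsWithin_iff.1 hU
    have hloc : ∀ p q, a ≤ p → b - δ < p → q < b + δ → IsometricOn c (Icc p q) := by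
      intro p q hap hp hq
      have key : ∀ s ∈ Icc p q, s ∈ U ∩ Ici a := fun s hs => by
        have hsa : a ≤ s := hap.trans hs.1
        refine ⟨hsub ⟨?_, hsa⟩, hsa⟩
        rw [Metric.mem_ball, Real.dist_eq, abs_lt]
        constructor <;> linarith [hs.1, hs.2]
      exact fun s hs t ht => h s (key s hs) t (key t ht)
    obtain ⟨m, hmS, hm⟩ := exists_lt_of_lt_csSup ⟨a, haS⟩ (show b - δ < sSup S by
      change b - δ < b; linarith)
    have hmb : m ≤ b := le_csSup hS hmS
    have hnew : b + δ / 2 ∈ S := by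
      refine ⟨by linarith, ?_⟩
      rcases hmS.1.eq_or_lt with rfl | ham
      · exact hloc _ _ le_rfl hm (by linarith)
      · set r := min (m - a) ((m - (b - δ)) / 2)
        have hr : 0 < r := lt_min (by linarith) (by linarith)
        have hr1 : r ≤ m - a := min_le_left _ _
        have hr2 : r ≤ (m - (b - δ)) / 2 := min_le_right _ _
        have := IsometricOn.glue hX (c := c) (a := a) (m := m) (r := r) (r' := b + δ / 2 - m) hr
          (by linarith) hmS.2 (hloc _ _ (by linarith) (by linarith) (by linarith))
        rwa [add_sub_cancel] at this
    linarith [le_csSup hS hnew]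
  · intro s hs t ht
    rw [not_bddAbove_iff] at hS
    obtain ⟨b, hb, hlt⟩ := hS (max s t)
    exact hb.2 s ⟨hs, (le_max_left _ _).trans hlt.le⟩ t ⟨ht, (le_max_right _ _).trans hlt.le⟩

theorem GeodesicRay.isometricOn (hX : IsCAT0 X) (c : GeodesicRay X) : IsometricOn c.1 (Ici 0) :=
  c.2.isometricOn hX

theorem GeodesicLine.isometricOn (hX : IsCAT0 X) (c : GeodesicLine X) : IsometricOn c.1 univ := by
  intro s _ t _
  have : IsGeodesicOn c.1 (Ici (min s t)) := fun u hu => by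
    obtain ⟨U, hU, h⟩ := c.2 u (mem_univ u)
    exact ⟨U, nhdsWithin_mono u (subset_univ _) hU, fun s₁ h₁ s₂ h₂ =>
      h s₁ ⟨h₁.1, mem_univ _⟩ s₂ ⟨h₂.1, mem_univ _⟩⟩
  exact this.isometricOn hX s (mem_Ici.2 (min_le_left _ _)) t (mem_Ici.2 (min_le_right _ _))

theorem IsometricOn.isGeodesicOn {c : ℝ → X} {I : Set ℝ} (h : IsometricOn c I) :
    IsGeodesicOn c I := fun _ _ => ⟨univ, Filter.univ_mem, fun s hs t ht => h s hs.2 t ht.2⟩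

theorem GeodesicRay.endpoint_eq_of_dist_le {c₁ c₂ : GeodesicRay X} {C : ℝ}
    (h : ∀ t, 0 ≤ t → dist (c₁.1 t) (c₂.1 t) ≤ C) : c₁.endpoint = c₂.endpoint := by
  refine Quotient.sound (s := asymptoticSetoid X) ?_
  refine ne_top_of_le_ne_top ENNReal.ofReal_ne_top (b := ENNReal.ofReal C)
    (Metric.hausdorffEDist_le_of_mem_edist ?_ ?_)
  · rintro _ ⟨t, ht, rfl⟩
    exact ⟨_, ⟨t, ht, rfl⟩, by rw [edist_dist]; exact ENNReal.ofReal_le_ofReal (h t ht)⟩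
  · rintro _ ⟨t, ht, rfl⟩
    exact ⟨_, ⟨t, ht, rfl⟩, by
      rw [edist_dist, dist_comm]; exact ENNReal.ofReal_le_ofReal (h t ht)⟩

/-- Both rays have unit speed, so the parameters of two nearby points differ at most by their
distance plus the distance of the starting points. Closeness of images thus becomes closeness at
equal times. -/
theorem GeodesicRay.exists_dist_le (hX : IsCAT0 X) {c₁ c₂ : GeodesicRay X}
    (h : c₁.endpoint = c₂.endpoint) : ∃ C, ∀ t, 0 ≤ t → dist (c₁.1 t) (c₂.1 t) ≤ C := by
  have hfin : Metric.hausdorffEDist (c₁.1 '' Ici 0) (c₂.1 '' Ici 0) ≠ ⊤ := Quotient.exact h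
  set D := Metric.hausdorffDist (c₁.1 '' Ici 0) (c₂.1 '' Ici 0) + 1
  refine ⟨2 * D + dist (c₁.1 0) (c₂.1 0), fun t ht => ?_⟩
  obtain ⟨_, ⟨s, hs, rfl⟩, hD⟩ := Metric.exists_dist_lt_of_hausdorffDist_lt
    (mem_image_of_mem c₁.1 (mem_Ici.2 ht)) (lt_add_one _) hfin
  have i₁ := c₁.isometricOn hX
  have i₂ := c₂.isometricOn hX
  have e1 := i₁.dist_of_le self_mem_Ici (mem_Ici.2 ht) ht
  have e2 := i₂.dist_of_le self_mem_Ici hs hs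
  have hst : |s - t| ≤ D + dist (c₁.1 0) (c₂.1 0) := by
    have t1 := dist_triangle4 (c₁.1 0) (c₂.1 0) (c₂.1 s) (c₁.1 t)
    have t2 := dist_triangle4 (c₂.1 0) (c₁.1 0) (c₁.1 t) (c₂.1 s)
    rw [dist_comm (c₂.1 s)] at t1
    rw [dist_comm (c₂.1 0) (c₁.1 0)] at t2
    rw [abs_le]; constructor <;> linarith
  have := i₂ s hs t ht
  linarith [dist_triangle (c₁.1 t) (c₂.1 s) (c₂.1 t)]

end LocalGlobal

/-- Stands for the limit `ε → 0` in convexity and first variation arguments. -/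
theorem le_of_forall_le_add_mul {A B C : ℝ} (h : ∀ ε : ℝ, 0 < ε → ε < 1 → A ≤ B + ε * C) :
    A ≤ B := by
  by_contra! hlt
  have hΔ : 0 < A - B := by linarith
  have hpos : 0 < A - B + |C| + 1 := by positivity
  have h1 := h ((A - B) / (A - B + |C| + 1)) (by positivity)
    (by rw [div_lt_one hpos]; linarith [abs_nonneg C])
  have h2 : (A - B) / (A - B + |C| + 1) * C ≤ (A - B) / (A - B + |C| + 1) * |C| :=
    mul_le_mul_of_nonneg_left (le_abs_self C) (by positivity)
  have h3 : (A - B) / (A - B + |C| + 1) * |C| < A - B := by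
    rw [div_mul_eq_mul_div, div_lt_iff₀ hpos]
    exact mul_lt_mul_of_pos_left (by linarith) hΔ
  linarith

/-! ### The flat strip theorem -/

section FlatStrip

variable {X : Type*} [MetricSpace X] (hX : IsCAT0 X)
include hX

theorem IsometricOn.frac_eq {c : ℝ → X} (hc : IsometricOn c univ) (s t : ℝ) {u : ℝ}
    (hu : u ∈ Icc (0 : ℝ) 1) : hX.frac (c s) (c t) u = c ((1 - u) * s + u * t) := by
  symm
  apply hX.eq_frac hu
  · rw [hc _ trivial _ trivial, hc _ trivial _ trivial,
      show s - ((1 - u) * s + u * t) = u * (s - t) by ring, abs_mul, abs_of_nonneg hu.1]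
  · rw [hc _ trivial _ trivial, hc _ trivial _ trivial,
      show (1 - u) * s + u * t - t = (1 - u) * (s - t) by ring, abs_mul,
      abs_of_nonneg (by linarith [hu.2] : 0 ≤ 1 - u)]

/-- Add the median inequalities from `y` and `w` to the midpoint of `xz`. -/
theorem IsCAT0.parallelogram_le (x y z w : X) :
    dist x z ^ 2 + dist y w ^ 2 ≤ dist x y ^ 2 + dist y z ^ 2 + dist z w ^ 2 + dist w x ^ 2 := by
  have hu : (1 / 2 : ℝ) ∈ Icc (0 : ℝ) 1 := by norm_num
  have h1 := hX.dist_frac_sq_le x z y hu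
  have h2 := hX.dist_frac_sq_le x z w hu
  set m := hX.frac x z (1 / 2)
  have h3 := dist_triangle_right y w m
  have h4 : dist y w ^ 2 ≤ 2 * (dist y m ^ 2 + dist w m ^ 2) := by
    have := pow_le_pow_left₀ dist_nonneg h3 2
    nlinarith [sq_nonneg (dist y m - dist w m)]
  rw [dist_comm x y, dist_comm z w]
  linarith

/-- A bounded convex function on `ℝ` is constant: `t` is compared with `s` and a point `r` far
beyond it. -/
theorem IsometricOn.dist_eq_of_bounded {σ τ : ℝ → X} (hσ : IsometricOn σ univ)
    (hτ : IsometricOn τ univ) {C : ℝ} (hC : ∀ t, dist (σ t) (τ t) ≤ C) (s t a : ℝ) :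
    dist (σ s) (τ (s + a)) = dist (σ t) (τ (t + a)) := by
  have key : ∀ s t, dist (σ t) (τ (t + a)) ≤ dist (σ s) (τ (s + a)) := by
    intro s t
    apply le_of_forall_le_add_mul (C := C + |a|)
    intro ε hε hε1
    have hε' : ε ∈ Icc (0 : ℝ) 1 := ⟨hε.le, hε1.le⟩
    set r := s + (t - s) / ε with hr
    have hrt : (1 - ε) * s + ε * r = t := by rw [hr]; field_simp; ring
    have h := hX.dist_frac_frac_le (σ s) (σ r) (τ (s + a)) (τ (r + a)) hε'
    rw [hσ.frac_eq hX _ _ hε', hτ.frac_eq hX _ _ hε', hrt,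
      show (1 - ε) * (s + a) + ε * (r + a) = t + a by rw [← hrt]; ring] at h
    have h1 : dist (σ r) (τ (r + a)) ≤ C + |a| := by
      have := hτ r trivial (r + a) trivial
      rw [sub_add_cancel_left, abs_neg] at this
      linarith [dist_triangle (σ r) (τ r) (τ (r + a)), hC r]
    nlinarith [dist_nonneg (x := σ s) (y := τ (s + a))]
  exact le_antisymm (key t s) (key s t)

/-- First variation at the nearest point `τ 0` gives `≥`. The parallelogram inequality for `σ 0, σ
a, τ a, τ 0` bounds the sum of both squared diagonals by `2(w² + a²)`, which forces equality. -/
theorem IsometricOn.dist_sq_eq {σ τ : ℝ → X} (hσ : IsometricOn σ univ) (hτ : IsometricOn τ univ)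
    (hconst : ∀ t a, dist (σ t) (τ (t + a)) = dist (σ 0) (τ a)) {w : ℝ}
    (hw : dist (σ 0) (τ 0) = w) (hmin : ∀ a, w ≤ dist (σ 0) (τ a)) (s t : ℝ) :
    dist (σ s) (τ t) ^ 2 = w ^ 2 + (s - t) ^ 2 := by
  have hw0 : 0 ≤ w := hw ▸ dist_nonneg
  have lower : ∀ a, w ^ 2 + a ^ 2 ≤ dist (σ 0) (τ a) ^ 2 := by
    intro a
    apply le_of_forall_le_add_mul (C := a ^ 2)
    intro ε hε hε1
    have h := hX.dist_frac_sq_le (τ 0) (τ a) (σ 0) (u := ε) ⟨hε.le, hε1.le⟩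
    rw [hτ.frac_eq hX _ _ ⟨hε.le, hε1.le⟩, hw, hτ 0 trivial a trivial, zero_sub, abs_neg,
      sq_abs] at h
    have h1 := pow_le_pow_left₀ hw0 (hmin ((1 - ε) * 0 + ε * a)) 2
    have h2 : ε * (w ^ 2 + a ^ 2) ≤ ε * (dist (σ 0) (τ a) ^ 2 + ε * a ^ 2) := by nlinarith
    exact le_of_mul_le_mul_left h2 hε
  have heq : ∀ a, dist (σ 0) (τ a) ^ 2 = w ^ 2 + a ^ 2 := by
    intro a
    refine le_antisymm ?_ (lower a)
    have h := hX.parallelogram_le (σ 0) (σ a) (τ a) (τ 0)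
    have h1 := hconst a (-a)
    have h2 := hconst a 0
    rw [add_neg_cancel] at h1
    rw [add_zero] at h2
    rw [h1, h2, hσ 0 trivial a trivial, hτ a trivial 0 trivial, dist_comm (τ 0), hw, zero_sub,
      sub_zero, abs_neg, sq_abs] at h
    have := lower (-a)
    rw [neg_sq] at this
    linarith
  have := hconst s (t - s)
  rw [add_sub_cancel] at this
  rw [this, heq]; ring

/-- Comparison gives `≤`. For `≥`, the Euclidean line through the two points is prolonged to both
edges of the strip: the distance of its ends is known exactly and the outer pieces are bounded
above. -/
theorem dist_frac_frac_sq_of_parallel {σ τ : ℝ → X} (hσ : IsometricOn σ univ)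
    (hτ : IsometricOn τ univ) {w : ℝ} (hw : 0 < w)
    (h : ∀ s t, dist (σ s) (τ t) ^ 2 = w ^ 2 + (s - t) ^ 2) (s t : ℝ) {u v : ℝ}
    (hu : u ∈ Icc (0 : ℝ) 1) (hv : v ∈ Icc (0 : ℝ) 1) :
    dist (hX.frac (σ s) (τ s) u) (hX.frac (σ t) (τ t) v) ^ 2 =
      (s - t) ^ 2 + (u - v) ^ 2 * w ^ 2 := by
  have hst : ∀ s, dist (σ s) (τ s) ^ 2 = w ^ 2 := fun s => by simp [h]
  have hst' : ∀ s, dist (σ s) (τ s) = w := fun s => by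
    rw [← abs_of_nonneg (dist_nonneg (x := σ s)), ← abs_of_pos hw]
    exact (sq_eq_sq_iff_abs_eq_abs _ _).1 (hst s)
  have hσσ : ∀ s t, dist (σ s) (σ t) ^ 2 = (s - t) ^ 2 := fun s t => by
    rw [hσ s trivial t trivial, sq_abs]
  have hττ : ∀ s t, dist (τ s) (τ t) ^ 2 = (s - t) ^ 2 := fun s t => by
    rw [hτ s trivial t trivial, sq_abs]
  have up1 : ∀ s t u, u ∈ Icc (0 : ℝ) 1 →
      dist (σ t) (hX.frac (σ s) (τ s) u) ^ 2 ≤ (s - t) ^ 2 + u ^ 2 * w ^ 2 := by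
    intro s t u hu
    have := hX.dist_frac_sq_le (σ s) (τ s) (σ t) hu
    rw [hσσ, h, hst] at this
    linarith
  have up2 : ∀ s t u, u ∈ Icc (0 : ℝ) 1 →
      dist (τ t) (hX.frac (σ s) (τ s) u) ^ 2 ≤ (s - t) ^ 2 + (1 - u) ^ 2 * w ^ 2 := by
    intro s t u hu
    have := hX.dist_frac_sq_le (σ s) (τ s) (τ t) hu
    rw [dist_comm _ (σ s), hττ, h, hst] at this
    linarith
  have up : ∀ s t u v, u ∈ Icc (0 : ℝ) 1 → v ∈ Icc (0 : ℝ) 1 →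
      dist (hX.frac (σ s) (τ s) u) (hX.frac (σ t) (τ t) v) ^ 2 ≤
        (s - t) ^ 2 + (u - v) ^ 2 * w ^ 2 := by
    intro s t u v hu hv
    have h1 := hX.dist_frac_sq_le (σ t) (τ t) (hX.frac (σ s) (τ s) u) hv
    have h2 := up1 s t u hu
    have h3 := up2 s t u hu
    rw [hst, dist_comm _ (σ t), dist_comm _ (τ t)] at h1
    have h4 := mul_le_mul_of_nonneg_left h2 (by linarith [hv.2] : 0 ≤ 1 - v)
    have h5 := mul_le_mul_of_nonneg_left h3 hv.1
    linarith
  have low1 : ∀ s t u v, u ∈ Icc (0 : ℝ) 1 → v ∈ Icc (0 : ℝ) 1 → u < v →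
      √((s - t) ^ 2 + (u - v) ^ 2 * w ^ 2) ≤
        dist (hX.frac (σ s) (τ s) u) (hX.frac (σ t) (τ t) v) := by
    intro s t u v hu hv huv
    have hvu : 0 < v - u := sub_pos.2 huv
    set D := √((s - t) ^ 2 + (u - v) ^ 2 * w ^ 2) with hD
    have hDsq : D ^ 2 = (s - t) ^ 2 + (u - v) ^ 2 * w ^ 2 := Real.sq_sqrt (by positivity)
    have hD0 : 0 ≤ D := Real.sqrt_nonneg _
    -- Stretching by `k` turns the height difference `v - u` into 1; `α` and `β` are the parameters
    -- where the prolonged line meets the edges `σ` and `τ`.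
    set k := (v - u)⁻¹ with hk
    have hk0 : 0 < k := inv_pos.2 hvu
    have hkvu : k * (v - u) = 1 := inv_mul_cancel₀ hvu.ne'
    set α := s - k * u * (t - s) with hα
    set β := t + k * (1 - v) * (t - s) with hβ
    have hkk : k ^ 2 * (u - v) ^ 2 = 1 := by
      rw [← mul_pow, show k * (u - v) = -1 by linarith]; norm_num
    have hkD : k ^ 2 * D ^ 2 = k ^ 2 * (s - t) ^ 2 + w ^ 2 := by
      rw [hDsq, mul_add, ← mul_assoc, hkk, one_mul]
    have e1 : dist (σ α) (hX.frac (σ s) (τ s) u) ≤ u * k * D := by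
      refine le_of_sq_le_sq ((up1 s α u hu).trans (le_of_eq ?_))
        (mul_nonneg (mul_nonneg hu.1 hk0.le) hD0)
      rw [mul_pow, mul_pow, mul_assoc, hkD, hα]; ring
    have e2 : dist (τ β) (hX.frac (σ t) (τ t) v) ≤ (1 - v) * k * D := by
      refine le_of_sq_le_sq ((up2 t β v hv).trans (le_of_eq ?_))
        (mul_nonneg (mul_nonneg (by linarith [hv.2]) hk0.le) hD0)
      rw [mul_pow, mul_pow, mul_assoc, hkD, hβ]; ring
    have e3 : k * D ≤ dist (σ α) (τ β) := by
      refine le_of_sq_le_sq (le_of_eq ?_) dist_nonneg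
      have hab : α - β = k * (s - t) := by
        have : (s - t) * (k * (v - u)) = s - t := by rw [hkvu, mul_one]
        rw [hα, hβ]; linarith
      rw [h, mul_pow, hkD, hab]; ring
    have h4 := dist_triangle4 (σ α) (hX.frac (σ s) (τ s) u) (hX.frac (σ t) (τ t) v) (τ β)
    rw [dist_comm (hX.frac (σ t) (τ t) v)] at h4
    have h5 : D * (k * (v - u)) = D := by rw [hkvu, mul_one]
    linarith
  have low2 : ∀ s t u v, u ∈ Icc (0 : ℝ) 1 → v ∈ Icc (0 : ℝ) 1 → u ≠ v →
      √((s - t) ^ 2 + (u - v) ^ 2 * w ^ 2) ≤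
        dist (hX.frac (σ s) (τ s) u) (hX.frac (σ t) (τ t) v) := by
    intro s t u v hu hv huv
    rcases huv.lt_or_gt with h' | h'
    · exact low1 s t u v hu hv h'
    · rw [dist_comm, ← neg_sq (s - t), ← neg_sq (u - v), neg_sub, neg_sub]
      exact low1 t s v u hv hu h'
  refine le_antisymm (up s t u v hu hv) ?_
  rcases eq_or_ne u v with rfl | huv
  -- A line at constant height meets neither edge, so `v` is moved slightly away from `u`.
  · rw [sub_self, zero_pow two_ne_zero, zero_mul, add_zero]
    refine sq_le_sq.2 ?_
    rw [abs_of_nonneg (dist_nonneg (x := hX.frac (σ s) (τ s) u))]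
    apply le_of_forall_le_add_mul (C := w)
    intro ε hε hε1
    obtain ⟨v, hv, huv, hne⟩ : ∃ v ∈ Icc (0 : ℝ) 1, |u - v| ≤ ε ∧ u ≠ v := by
      rcases le_or_gt u (1 / 2) with h' | h'
      · refine ⟨u + ε / 2, ⟨by linarith [hu.1], by linarith⟩, ?_, by linarith⟩
        rw [sub_add_cancel_left, abs_neg, abs_of_pos (by positivity)]; linarith
      · refine ⟨u - ε / 2, ⟨by linarith, by linarith [hu.2]⟩, ?_, by linarith⟩
        rw [sub_sub_cancel, abs_of_pos (by positivity)]; linarith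
    have h1 := low2 s t u v hu hv hne
    have h2 : |s - t| ≤ √((s - t) ^ 2 + (u - v) ^ 2 * w ^ 2) :=
      Real.abs_le_sqrt (by nlinarith [mul_nonneg (sq_nonneg (u - v)) (sq_nonneg w)])
    have h3 := hX.dist_frac_frac (σ t) (τ t) hu hv
    rw [hst'] at h3
    have h4 := mul_le_mul_of_nonneg_right huv hw.le
    linarith [dist_triangle (hX.frac (σ s) (τ s) u) (hX.frac (σ t) (τ t) u)
      (hX.frac (σ t) (τ t) v)]
  · have := pow_le_pow_left₀ (Real.sqrt_nonneg _) (low2 s t u v hu hv huv) 2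
    rwa [Real.sq_sqrt (by positivity)] at this

/-- The flat strip theorem. -/
theorem GeodesicLine.boundsFlatStrip_of_parallel (c : GeodesicLine X) {τ : ℝ → X}
    (hτ : IsometricOn τ univ) {C : ℝ} (hC : ∀ t, dist (c.1 t) (τ t) ≤ C)
    {s : ℝ} (hs : c.1 s ∉ range τ) : c.BoundsFlatStrip := by
  have hσ := c.isometricOn hX
  have hconst := fun t a => hσ.dist_eq_of_bounded hX hτ hC t 0 a
  simp only [zero_add] at hconst
  have hcont : Continuous τ := by
    refine (LipschitzWith.of_dist_le_mul (K := 1) fun s t => ?_).continuous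
    rw [hτ s trivial t trivial, NNReal.coe_one, one_mul, Real.dist_eq]
  have hC0 : 0 ≤ C := dist_nonneg.trans (hC 0)
  -- Outside `[-2C, 2C]` the distance to `c 0` is at least `C`, hence no smaller than at `0`.
  obtain ⟨a₀, -, ha₀⟩ := (isCompact_Icc (a := -(2 * C)) (b := 2 * C)).exists_isMinOn
    ⟨0, by linarith, by linarith⟩ (f := fun a => dist (c.1 0) (τ a))
    (continuous_const.dist hcont).continuousOn
  have hmin : ∀ a, dist (c.1 0) (τ a₀) ≤ dist (c.1 0) (τ a) := by
    intro a
    by_cases ha : a ∈ Icc (-(2 * C)) (2 * C)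
    · exact ha₀ ha
    · have h1 : dist (c.1 0) (τ a₀) ≤ dist (c.1 0) (τ 0) :=
        ha₀ (show (0 : ℝ) ∈ Icc (-(2 * C)) (2 * C) from ⟨by linarith, by linarith⟩)
      have h2 : 2 * C ≤ |a| := by
        by_contra! hlt
        exact ha ⟨(abs_le.1 hlt.le).1, (abs_le.1 hlt.le).2⟩
      have h3 := hτ 0 trivial a trivial
      rw [zero_sub, abs_neg] at h3
      have := dist_triangle_left (τ 0) (τ a) (c.1 0)
      linarith [hC 0]
  have hw : 0 < dist (c.1 0) (τ a₀) := by
    rw [← hconst s a₀]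
    exact dist_pos.2 fun h => hs ⟨_, h.symm⟩
  have hτ' : IsometricOn (fun t => τ (t + a₀)) univ := fun s _ t _ => by
    rw [hτ _ trivial _ trivial, add_sub_add_right_eq_sub]
  set w := dist (c.1 0) (τ a₀) with hwdef
  have hsq := hσ.dist_sq_eq hX hτ' (fun t a => by rw [add_assoc, hconst]) (w := w)
    (by rw [zero_add]) (fun a => hmin _)
  have hflat := fun s t u v hu hv =>
    dist_frac_frac_sq_of_parallel hX hσ hτ' hw hsq s t (u := u) (v := v) hu hv
  have hdiv : ∀ y, y ∈ Icc 0 w → y / w ∈ Icc (0 : ℝ) 1 := fun y hy =>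
    ⟨div_nonneg hy.1 hw.le, div_le_one_of_le₀ hy.2 hw.le⟩
  refine ⟨w, hw, fun p => hX.frac (c.1 (p 0)) (τ (p 0 + a₀)) (p 1 / w), fun p q hp hq => ?_,
    fun t => by simp⟩
  have := hflat (p 0) (q 0) _ _ (hdiv _ hp) (hdiv _ hq)
  rw [EuclideanSpace.dist_eq, Fin.sum_univ_two, Real.dist_eq, Real.dist_eq, sq_abs, sq_abs]
  rw [← Real.sqrt_sq (dist_nonneg (x := hX.frac _ _ _)), this]
  congr 2
  field_simp

end FlatStrip

/-! ### Limits of segments -/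

section Limit

variable {X : Type*} [MetricSpace X] (hX : IsCAT0 X)

theorem IsCAT0.exists_pt_eq_frac (x y : X) (t : ℝ) :
    ∃ v ∈ Icc (0 : ℝ) 1, hX.pt x y t = hX.frac x y v := by
  rcases le_total t 0 with h | h
  · refine ⟨0, ⟨le_rfl, zero_le_one⟩, ?_⟩
    have : max 0 (min t (dist x y)) = 0 := max_eq_left ((min_le_left _ _).trans h)
    rw [hX.frac_zero, IsCAT0.pt, this]
    exact (hX.exists_segment x y).choose_spec.start
  · rcases le_total (dist x y) t with h' | h'
    · exact ⟨1, ⟨zero_le_one, le_rfl⟩, by rw [hX.pt_of_le _ _ h', hX.frac_one]⟩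
    · exact ⟨_, ⟨by positivity, div_le_one_of_le₀ h' dist_nonneg⟩, hX.pt_eq_frac ⟨h, h'⟩⟩

/-- Seen from `b`, contraction accounts for one `|oz|` and the difference of the lengths `|zb|` and
`|ob|` for the other. -/
theorem IsCAT0.dist_pt_sub_pt_le (o z b : X) {t : ℝ} (ht : 0 ≤ t) (hz : t ≤ dist z b)
    (ho : t ≤ dist o b) : dist (hX.pt b z (dist z b - t)) (hX.pt o b t) ≤ 2 * dist o z := by
  rw [← hX.pt_symm ⟨ht, ho⟩]
  have h1 := hX.dist_pt_pt_le_dist b z o (r := dist z b - t) (by linarith)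
  have h2 := hX.dist_pt_pt_le b o (dist z b - t) (dist o b - t)
  have h3 : |dist z b - t - (dist o b - t)| ≤ dist o z := by
    rw [sub_sub_sub_cancel_right, dist_comm o z]
    exact abs_dist_sub_le _ _ _
  rw [dist_comm z o] at h1
  linarith [dist_triangle (hX.pt b z (dist z b - t)) (hX.pt b o (dist z b - t))
    (hX.pt b o (dist o b - t))]

/-- Segments that pass near `o` and whose end points go to infinity subconverge to a line. -/
theorem IsCAT0.exists_limit_line [ProperSpace X] (o : X) {R C : ℝ} (a b : ℕ → X) (u : ℕ → ℝ)
    (hu : ∀ n, u n ∈ Icc (0 : ℝ) 1) (hz : ∀ n, dist o (hX.frac (a n) (b n) (u n)) ≤ R)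
    (ρ₁ ρ₂ : ℝ → X)
    (ha : ∀ t, 0 ≤ t → ∀ᶠ n in Filter.atTop,
      t ≤ dist o (a n) ∧ dist (hX.pt o (a n) t) (ρ₁ t) ≤ C)
    (hb : ∀ t, 0 ≤ t → ∀ᶠ n in Filter.atTop,
      t ≤ dist o (b n) ∧ dist (hX.pt o (b n) t) (ρ₂ t) ≤ C) :
    ∃ τ : ℝ → X, IsometricOn τ univ ∧ (∀ t, 0 ≤ t → dist (τ (-t)) (ρ₁ t) ≤ 2 * R + C) ∧
      (∀ t, 0 ≤ t → dist (τ t) (ρ₂ t) ≤ 2 * R + C) ∧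
      ∀ r, (∀ n, ∀ v ∈ Icc (0 : ℝ) 1, r ≤ dist o (hX.frac (a n) (b n) v)) →
        ∀ t, r ≤ dist o (τ t) := by
  have hR : 0 ≤ R := dist_nonneg.trans (hz 0)
  set m : ℕ → ℝ := fun n => u n * dist (a n) (b n) with hm
  have hmem : ∀ n, m n ∈ Icc 0 (dist (a n) (b n)) := fun n => IsCAT0.mul_dist_mem (hu n)
  set z : ℕ → X := fun n => hX.pt (a n) (b n) (m n) with hzdef
  have hz' : ∀ n, dist o (z n) ≤ R := hz
  have haz : ∀ n, dist (z n) (a n) = m n := fun n => by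
    rw [dist_comm]; exact hX.dist_left_pt _ _ (hmem n)
  have hzb : ∀ n, dist (z n) (b n) = dist (a n) (b n) - m n := fun n =>
    hX.dist_pt_right _ _ (hmem n)
  have hma : ∀ t, 0 ≤ t → ∀ᶠ n in Filter.atTop, t ≤ m n := by
    intro t ht
    filter_upwards [ha (t + R) (by linarith)] with n hn
    have := dist_triangle o (z n) (a n)
    rw [haz] at this
    linarith [hz' n, hn.1]
  have hmb : ∀ t, 0 ≤ t → ∀ᶠ n in Filter.atTop, t ≤ dist (a n) (b n) - m n := by
    intro t ht
    filter_upwards [hb (t + R) (by linarith)] with n hn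
    have := dist_triangle o (z n) (b n)
    rw [hzb] at this
    linarith [hz' n, hn.1]
  set τn : ℕ → ℝ → X := fun n t => hX.pt (a n) (b n) (m n + t) with hτn
  have hrange : ∀ t, ∀ᶠ n in Filter.atTop, m n + t ∈ Icc 0 (dist (a n) (b n)) := by
    intro t
    filter_upwards [hma |t| (abs_nonneg t), hmb |t| (abs_nonneg t)] with n h1 h2
    constructor <;> linarith [neg_abs_le t, le_abs_self t]
  -- An ultrafilter gives limits for all `t` at once, without a diagonal sequence.
  set 𝒰 := Filter.hyperfilter ℕ
  have h𝒰 : (𝒰 : Filter ℕ) ≤ Filter.atTop := Nat.hyperfilter_le_atTop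
  have hlim : ∀ t, ∃ p, Filter.Tendsto (fun n => τn n t) 𝒰 (𝓝 p) := by
    intro t
    have hin : ∀ n, τn n t ∈ Metric.closedBall o (R + |t|) := by
      intro n
      rw [Metric.mem_closedBall']
      have := hX.dist_pt_pt_le (a n) (b n) (m n) (m n + t)
      rw [sub_add_cancel_left, abs_neg] at this
      linarith [dist_triangle o (z n) (τn n t), hz' n]
    obtain ⟨p, -, hp⟩ := (isCompact_closedBall o (R + |t|)).ultrafilter_le_nhds
      (𝒰.map fun n => τn n t) (by
        rw [Filter.le_principal_iff]
        exact Filter.Eventually.of_forall (f := 𝒰) (p := fun n => τn n t ∈ _) hin)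
    exact ⟨p, hp⟩
  choose τ hτ using hlim
  refine ⟨τ, fun s _ t _ => ?_, fun t ht => ?_, fun t ht => ?_, fun r hr t => ?_⟩
  · refine tendsto_nhds_unique ((hτ s).dist (hτ t)) (tendsto_const_nhds.congr' ?_)
    filter_upwards [h𝒰 (hrange s), h𝒰 (hrange t)] with n h1 h2
    rw [hτn, hX.dist_pt_pt _ _ h1 h2, add_sub_add_left_eq_sub]
  · refine le_of_tendsto ((hτ (-t)).dist tendsto_const_nhds) ?_
    filter_upwards [h𝒰 (ha t ht), h𝒰 (hma t ht)] with n h1 h2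
    have h3 := hX.dist_pt_sub_pt_le o (z n) (a n) ht (by rwa [haz]) h1.1
    rw [haz, hzdef, hX.pt_pt _ _ (by linarith) (by linarith) (hmem n).2, sub_eq_add_neg] at h3
    linarith [dist_triangle (τn n (-t)) (hX.pt o (a n) t) (ρ₁ t), hz' n]
  · refine le_of_tendsto ((hτ t).dist tendsto_const_nhds) ?_
    filter_upwards [h𝒰 (hb t ht), h𝒰 (hmb t ht)] with n h1 h2
    have h3 := hX.dist_pt_sub_pt_le o (z n) (b n) ht (by rwa [hzb]) h1.1
    have e1 : z n = hX.pt (b n) (a n) (dist (a n) (b n) - m n) := (hX.pt_symm (hmem n)).symm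
    have e2 : hX.pt (b n) (z n) (dist (z n) (b n) - t) = τn n t := by
      rw [hzb, e1, hX.pt_pt _ _ (by linarith) (by linarith)
        (by rw [dist_comm]; linarith [(hmem n).1]), sub_sub]
      exact hX.pt_symm ⟨by linarith [(hmem n).1], by linarith⟩
    rw [e2] at h3
    linarith [dist_triangle (τn n t) (hX.pt o (b n) t) (ρ₂ t), hz' n]
  · refine ge_of_tendsto (tendsto_const_nhds.dist (hτ t)) (Filter.Eventually.of_forall fun n => ?_)
    obtain ⟨v, hv, e⟩ := hX.exists_pt_eq_frac (a n) (b n) (m n + t)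
    exact (hr n v hv).trans_eq (by rw [← e])

end Limit

/-! ### Segments close to a line without flat strip -/

section Key

variable {X : Type*} [MetricSpace X]

/-- Segments whose end points lie far out in the directions of the two ends of a line that bounds
no flat strip pass near a given point of the line. -/
theorem GeodesicLine.exists_segment_near [ProperSpace X] (hX : IsCAT0 X) (c : GeodesicLine X)
    (hc : ¬ c.BoundsFlatStrip) (s₀ : ℝ) {R : ℝ} (hR : 0 < R) :
    ∃ K : ℝ, 0 < K ∧ ∀ a b : X, K ≤ dist (c.1 s₀) a → K ≤ dist (c.1 s₀) b →
      dist (hX.pt (c.1 s₀) a K) (c.1 (s₀ - K)) ≤ 1 →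
      dist (hX.pt (c.1 s₀) b K) (c.1 (s₀ + K)) ≤ 1 →
      ∃ u ∈ Icc (0 : ℝ) 1, dist (c.1 s₀) (hX.frac a b u) < R := by
  by_contra! hcon
  have hiso := c.isometricOn hX
  set o := c.1 s₀ with ho
  have hKpos : ∀ n : ℕ, (0 : ℝ) < n + 1 := fun n => by positivity
  choose a b hKa hKb ha hb hfar using fun n : ℕ => hcon (n + 1) (hKpos n)
  -- The ends are pulled back to distance at most `k` from `o`. For the least `k` with `P n k` the
  -- segment misses the `R`-ball, while the one for `k - 1` meets it; hence it comes within `R + 1`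
  -- of `o`.
  let P : ℕ → ℕ → Prop := fun n k => ∀ v ∈ Icc (0 : ℝ) 1,
    R ≤ dist o (hX.frac (hX.pt o (a n) k) (hX.pt o (b n) k) v)
  have hP : ∀ n, ∃ k, P n k := by
    intro n
    obtain ⟨k, hk⟩ := exists_nat_ge (max (dist o (a n)) (dist o (b n)))
    refine ⟨k, fun v hv => ?_⟩
    rw [hX.pt_of_le _ _ ((le_max_left _ _).trans hk), hX.pt_of_le _ _ ((le_max_right _ _).trans hk)]
    exact hfar n v hv
  classical
  let k : ℕ → ℕ := fun n => Nat.find (hP n)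
  have hk : ∀ n, P n (k n) := fun n => Nat.find_spec (hP n)
  have hnear : ∀ n, ∃ v ∈ Icc (0 : ℝ) 1,
      dist o (hX.frac (hX.pt o (a n) (k n)) (hX.pt o (b n) (k n)) v) ≤ R + 1 := by
    intro n
    have hk0 : k n ≠ 0 := by
      intro h0
      have := hk n 0 ⟨le_rfl, zero_le_one⟩
      rw [h0, Nat.cast_zero, hX.pt_zero, hX.frac_zero, dist_self] at this
      linarith
    obtain ⟨j, hj⟩ := Nat.exists_eq_succ_of_ne_zero hk0
    have hnot : ¬ P n j := Nat.find_min (hP n) (by change j < k n; omega)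
    simp only [P, not_forall, not_le] at hnot
    obtain ⟨v, hv, hlt⟩ := hnot
    refine ⟨v, hv, ?_⟩
    have h1 := hX.dist_frac_frac_le (hX.pt o (a n) j) (hX.pt o (b n) j) (hX.pt o (a n) (k n))
      (hX.pt o (b n) (k n)) hv
    have hj1 : |(j : ℝ) - k n| = 1 := by rw [hj]; push_cast; simp
    have h2 := hX.dist_pt_pt_le o (a n) j (k n)
    have h3 := hX.dist_pt_pt_le o (b n) j (k n)
    rw [hj1] at h2 h3
    have h4 := mul_le_mul_of_nonneg_left h2 (by linarith [hv.2] : 0 ≤ 1 - v)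
    have h5 := mul_le_mul_of_nonneg_left h3 hv.1
    linarith [dist_triangle o (hX.frac (hX.pt o (a n) j) (hX.pt o (b n) j) v)
      (hX.frac (hX.pt o (a n) (k n)) (hX.pt o (b n) (k n)) v)]
  have hclose : ∀ (n : ℕ) (p : X) (s t : ℝ), (n : ℝ) + 1 ≤ dist o p → 0 ≤ t → t ≤ n + 1 →
      (s = 1 ∨ s = -1) → dist (hX.pt o p (n + 1)) (c.1 (s₀ + s * (n + 1))) ≤ 1 →
      dist (hX.pt o p t) (c.1 (s₀ + s * t)) ≤ t / (n + 1) := by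
    intro n p s t hp ht htn hs hd
    have habs : |s| = 1 := by rcases hs with rfl | rfl <;> simp
    have hd0 : ∀ r, 0 ≤ r → dist o (c.1 (s₀ + s * r)) = r := fun r hr => by
      rw [ho, hiso _ trivial _ trivial, sub_add_cancel_left, abs_neg, abs_mul, habs, one_mul,
        abs_of_nonneg hr]
    have e1 : c.1 (s₀ + s * t) = hX.pt o (c.1 (s₀ + s * (n + 1))) t := by
      apply hX.eq_pt (hd0 t ht)
      rw [hd0 _ (hKpos n).le, hiso _ trivial _ trivial, add_sub_add_left_eq_sub, ← mul_sub, abs_mul,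
        habs, one_mul, abs_sub_comm, abs_of_nonneg (by linarith)]
    rw [e1, ← hX.pt_pt o p ht htn hp]
    have := hX.dist_pt_pt_le_mul o (hX.pt o p (n + 1)) (c.1 (s₀ + s * (n + 1))) ht htn (hKpos n)
      (hX.dist_left_pt o p ⟨(hKpos n).le, hp⟩).ge (hd0 _ (hKpos n).le).ge
    exact this.trans (mul_le_of_le_one_right (div_nonneg ht (hKpos n).le) hd)
  have hclosea : ∀ (n : ℕ) (t : ℝ), 0 ≤ t → t ≤ n + 1 →
      dist (hX.pt o (a n) t) (c.1 (s₀ - t)) ≤ t / (n + 1) := fun n t h0 h1 => by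
    have := hclose n (a n) (-1) t (hKa n) h0 h1 (Or.inr rfl)
      (by rw [neg_one_mul, ← sub_eq_add_neg]; exact ha n)
    rwa [neg_one_mul, ← sub_eq_add_neg] at this
  have hcloseb : ∀ (n : ℕ) (t : ℝ), 0 ≤ t → t ≤ n + 1 →
      dist (hX.pt o (b n) t) (c.1 (s₀ + t)) ≤ t / (n + 1) := fun n t h0 h1 => by
    have := hclose n (b n) 1 t (hKb n) h0 h1 (Or.inl rfl) (by rw [one_mul]; exact hb n)
    rwa [one_mul] at this
  -- If `k n < n + 1`, the ends are within `k n / (n + 1)` of `c (s₀ ± k n)`. So is the midpoint of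
  -- `o`, and it has distance at least `R` from `o`.
  have hklarge : ∀ n : ℕ, min 1 R * (n + 1) ≤ k n := by
    intro n
    rcases le_or_gt ((n : ℝ) + 1) (k n) with h | h
    · exact (mul_le_of_le_one_left (hKpos n).le (min_le_left _ _)).trans h
    · have hu : (1 / 2 : ℝ) ∈ Icc (0 : ℝ) 1 := by norm_num
      have h1 := hk n _ hu
      have h2 := hX.dist_frac_frac_le (c.1 (s₀ - k n)) (c.1 (s₀ + k n)) (hX.pt o (a n) (k n))
        (hX.pt o (b n) (k n)) hu
      have h3 := hclosea n (k n) (Nat.cast_nonneg _) h.le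
      have h4 := hcloseb n (k n) (Nat.cast_nonneg _) h.le
      rw [hiso.frac_eq hX _ _ hu, show (1 - 1 / 2 : ℝ) * (s₀ - k n) + 1 / 2 * (s₀ + k n) = s₀ by ring,
        dist_comm (c.1 (s₀ - k n)), dist_comm (c.1 (s₀ + k n))] at h2
      have h5 : R ≤ k n / (n + 1) := by linarith
      rw [le_div_iff₀ (hKpos n)] at h5
      exact (mul_le_mul_of_nonneg_right (min_le_right _ _) (hKpos n).le).trans h5
  have hmin : 0 < min 1 R := lt_min one_pos hR
  have hev : ∀ t : ℝ, ∀ᶠ n : ℕ in Filter.atTop, t ≤ k n ∧ t ≤ n + 1 := by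
    intro t
    have htend : Filter.Tendsto (fun n : ℕ => min 1 R * ((n : ℝ) + 1)) Filter.atTop Filter.atTop :=
      (Filter.tendsto_atTop_add_const_right _ _ tendsto_natCast_atTop_atTop).const_mul_atTop hmin
    filter_upwards [htend.eventually_ge_atTop t] with n hn
    exact ⟨hn.trans (hklarge n), hn.trans (mul_le_of_le_one_left (hKpos n).le (min_le_left _ _))⟩
  have hend : ∀ (p : X) (n : ℕ) (t : ℝ), 0 ≤ t → t ≤ k n → t ≤ dist o p →
      t ≤ dist o (hX.pt o p (k n)) ∧ hX.pt o (hX.pt o p (k n)) t = hX.pt o p t := by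
    intro p n t h0 h1 h2
    rcases le_or_gt (k n : ℝ) (dist o p) with h | h
    · exact ⟨by rwa [hX.dist_left_pt o p ⟨Nat.cast_nonneg _, h⟩], hX.pt_pt o p h0 h1 h⟩
    · rw [hX.pt_of_le o p h.le]; exact ⟨h2, rfl⟩
  choose u hu hz using hnear
  obtain ⟨τ, hτ, hτ1, hτ2, hτ3⟩ := hX.exists_limit_line o (R := R + 1) (C := 1)
    (fun n => hX.pt o (a n) (k n)) (fun n => hX.pt o (b n) (k n)) u hu hz
    (fun t => c.1 (s₀ - t)) (fun t => c.1 (s₀ + t)) (fun t ht => by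
      filter_upwards [hev t] with n hn
      obtain ⟨h1, h2⟩ := hend (a n) n t ht hn.1 (hn.2.trans (hKa n))
      refine ⟨h1, ?_⟩
      rw [h2]
      exact (hclosea n t ht hn.2).trans (div_le_one_of_le₀ hn.2 (hKpos n).le)) (fun t ht => by
      filter_upwards [hev t] with n hn
      obtain ⟨h1, h2⟩ := hend (b n) n t ht hn.1 (hn.2.trans (hKb n))
      refine ⟨h1, ?_⟩
      rw [h2]
      exact (hcloseb n t ht hn.2).trans (div_le_one_of_le₀ hn.2 (hKpos n).le))
  have hτ' : IsometricOn (fun t => τ (t - s₀)) univ := fun s _ t _ => by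
    rw [hτ _ trivial _ trivial, sub_sub_sub_cancel_right]
  refine hc (c.boundsFlatStrip_of_parallel hX hτ' (C := 2 * (R + 1) + 1) (fun t => ?_) (s := s₀) ?_)
  · rw [dist_comm]
    rcases le_total s₀ t with h | h
    · have := hτ2 (t - s₀) (sub_nonneg.2 h)
      rwa [add_sub_cancel] at this
    · have := hτ1 (s₀ - t) (sub_nonneg.2 h)
      rwa [neg_sub, sub_sub_cancel] at this
  · rintro ⟨t, ht⟩
    have h1 := hτ3 R hk (t - s₀)
    have h2 : τ (t - s₀) = o := ht
    rw [h2, dist_self] at h1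
    linarith

end Key

/-! ### Cone neighbourhoods, joining lines and projections -/

section Boundary

variable {X : Type*} [MetricSpace X]

theorem IsometricOn.pt_ray_eq (hX : IsCAT0 X) {ρ : ℝ → X} (hρ : IsometricOn ρ (Ici 0)) {t n : ℝ}
    (ht : 0 ≤ t) (htn : t ≤ n) : hX.pt (ρ 0) (ρ n) t = ρ t := by
  have h : uIcc 0 n = Icc 0 n := uIcc_of_le (ht.trans htn)
  have := IsometricOn.pt_eq hX (c := ρ) (s := 0) (t := n) (r := t)
    (hρ.mono (h ▸ Icc_subset_Ici_self)) (h ▸ ⟨ht, htn⟩)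
  rwa [sub_zero, abs_of_nonneg ht] at this

/-- `p n` and `c n` stay within some `C`; contraction towards `c 0` scales this by `K / (n - C)`. -/
theorem GeodesicRay.tendsto_pt (hX : IsCAT0 X) {c p : GeodesicRay X}
    (h : c.endpoint = p.endpoint) {K : ℝ} (hK : 0 < K) {δ : ℝ} (hδ : 0 < δ) :
    ∀ᶠ n : ℕ in Filter.atTop, K ≤ dist (c.1 0) (p.1 n) ∧
      dist (hX.pt (c.1 0) (p.1 n) K) (c.1 K) < δ := by
  obtain ⟨C, hC⟩ := GeodesicRay.exists_dist_le hX h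
  have hC0 : 0 ≤ C := dist_nonneg.trans (hC 0 le_rfl)
  have hi := c.isometricOn hX
  obtain ⟨N, hN⟩ := exists_nat_gt (K + C + K * C / δ)
  filter_upwards [Filter.eventually_ge_atTop N] with n hn
  have hnN : K + C + K * C / δ < n := hN.trans_le (Nat.cast_le.2 hn)
  have hpos : 0 ≤ K * C / δ := by positivity
  have hn0 : (0 : ℝ) ≤ n := Nat.cast_nonneg n
  have h1 : dist (c.1 0) (c.1 n) = n := by
    rw [hi.dist_of_le self_mem_Ici (mem_Ici.2 hn0) hn0, sub_zero]
  have h2 : (n : ℝ) - C ≤ dist (c.1 0) (p.1 n) := by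
    have := dist_triangle_right (c.1 0) (c.1 n) (p.1 n)
    linarith [hC n hn0]
  have hM : 0 < (n : ℝ) - C := by linarith
  refine ⟨by linarith, ?_⟩
  have h3 := hX.dist_pt_pt_le_mul (c.1 0) (p.1 n) (c.1 n) hK.le
    (by linarith : K ≤ (n : ℝ) - C) hM h2 (by linarith)
  rw [hi.pt_ray_eq hX hK.le (by linarith), dist_comm (p.1 n)] at h3
  refine h3.trans_lt ?_
  have h4 : K / (n - C) * dist (c.1 n) (p.1 n) ≤ K / (n - C) * C :=
    mul_le_mul_of_nonneg_left (hC n hn0) (by positivity)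
  refine h4.trans_lt ?_
  rw [div_mul_eq_mul_div, div_lt_iff₀ hM, mul_comm δ, ← div_lt_iff₀ hδ]
  linarith

theorem GeodesicRay.eq_of_endpoint_eq (hX : IsCAT0 X) {c p : GeodesicRay X}
    (h : c.endpoint = p.endpoint) (h0 : c.1 0 = p.1 0) {t : ℝ} (ht : 0 < t) : c.1 t = p.1 t := by
  by_contra hne
  obtain ⟨n, hn, hnt⟩ := ((GeodesicRay.tendsto_pt hX h ht (dist_pos.2 hne)).and
    ((tendsto_natCast_atTop_atTop (R := ℝ)).eventually_ge_atTop t)).exists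
  have := hn.2
  rw [h0, (p.isometricOn hX).pt_ray_eq hX ht.le hnt, dist_comm] at this
  exact this.false

theorem coneNhd_mem_nhds {ξ : IdealBoundary X} {c : GeodesicRay X} (hc : c.endpoint = ξ) {K δ : ℝ}
    (hK : 0 < K) (hδ : 0 < δ) : coneNhd ξ (c.1 0) K δ ∈ 𝓝 ξ :=
  IsOpen.mem_nhds (TopologicalSpace.isOpen_generateFrom_of_mem ⟨ξ, _, K, δ, hK, hδ, rfl⟩)
    ⟨c, c, rfl, hc, rfl, hc, by simpa⟩

/-- `coneNhd` only asserts that some ray to `ξ` is close at time `K`; uniqueness of rays from a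
point identifies it with `c`. -/
theorem exists_ray_of_mem_coneNhd (hX : IsCAT0 X) {ξ η : IdealBoundary X} {c : GeodesicRay X}
    (hc : c.endpoint = ξ) {K δ : ℝ} (hK : 0 < K) (hη : η ∈ coneNhd ξ (c.1 0) K δ) :
    ∃ p : GeodesicRay X, p.1 0 = c.1 0 ∧ p.endpoint = η ∧ dist (p.1 K) (c.1 K) < δ := by
  obtain ⟨c', p, h1, h2, h3, h4, h5⟩ := hη
  refine ⟨p, h3, h4, ?_⟩
  rwa [dist_comm, ← GeodesicRay.eq_of_endpoint_eq hX (h2.trans hc.symm) h1 hK]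

theorem GeodesicLine.exists_posRay (hX : IsCAT0 X) (d : GeodesicLine X) (s : ℝ) :
    ∃ c : GeodesicRay X, (∀ t, c.1 t = d.1 (s + t)) ∧ c.endpoint = d.posEnd := by
  have hi := d.isometricOn hX
  refine ⟨⟨fun t => d.1 (s + t), IsometricOn.isGeodesicOn fun a _ b _ => ?_⟩, fun t => rfl,
    GeodesicRay.endpoint_eq_of_dist_le (C := |s|) fun t _ => ?_⟩
  · rw [hi _ trivial _ trivial, add_sub_add_left_eq_sub]
  · exact (hi _ trivial _ trivial).trans_le (by rw [add_sub_cancel_right])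

theorem GeodesicLine.exists_negRay (hX : IsCAT0 X) (d : GeodesicLine X) (s : ℝ) :
    ∃ c : GeodesicRay X, (∀ t, c.1 t = d.1 (s - t)) ∧ c.endpoint = d.negEnd := by
  have hi := d.isometricOn hX
  refine ⟨⟨fun t => d.1 (s - t), IsometricOn.isGeodesicOn fun a _ b _ => ?_⟩, fun t => rfl,
    GeodesicRay.endpoint_eq_of_dist_le (C := |s|) fun t _ => ?_⟩
  · rw [hi _ trivial _ trivial, sub_sub_sub_cancel_left, abs_sub_comm]
  · exact (hi _ trivial _ trivial).trans_le (by rw [sub_neg_eq_add, sub_add_cancel])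

/-- Membership in a cone neighbourhood already supplies a ray from `d s`. The rays `p` and `q` may
start anywhere, so the two halves of any line are allowed. Cone radius and convergence error, 1/2
each, add up to the tolerance 1 of `exists_segment_near`. -/
theorem GeodesicLine.exists_nhds_segment_near [ProperSpace X] (hX : IsCAT0 X) (d : GeodesicLine X)
    (hd : ¬ d.BoundsFlatStrip) (s : ℝ) {r : ℝ} (hr : 0 < r) :
    ∃ U ∈ 𝓝 d.posEnd, ∃ V ∈ 𝓝 d.negEnd,
      (∀ ξ ∈ U, ∃ c : GeodesicRay X, c.1 0 = d.1 s ∧ c.endpoint = ξ) ∧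
      (∀ η ∈ V, ∃ c : GeodesicRay X, c.1 0 = d.1 s ∧ c.endpoint = η) ∧
      ∀ p q : GeodesicRay X, p.endpoint ∈ U → q.endpoint ∈ V → ∀ᶠ n : ℕ in Filter.atTop,
        ∃ u ∈ Icc (0 : ℝ) 1, dist (d.1 s) (hX.frac (q.1 n) (p.1 n) u) < r := by
  obtain ⟨K, hK, hnear⟩ := d.exists_segment_near hX hd s hr
  obtain ⟨c₁, hc₁, he₁⟩ := d.exists_posRay hX s
  obtain ⟨c₂, hc₂, he₂⟩ := d.exists_negRay hX s
  have h₁ : c₁.1 0 = d.1 s := by rw [hc₁, add_zero]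
  have h₂ : c₂.1 0 = d.1 s := by rw [hc₂, sub_zero]
  have half : (0 : ℝ) < 1 / 2 := by norm_num
  have hU := coneNhd_mem_nhds he₁ hK half
  have hV := coneNhd_mem_nhds he₂ hK half
  refine ⟨_, hU, _, hV, fun ξ hξ => ?_, fun η hη => ?_, fun p q hp hq => ?_⟩
  · obtain ⟨c, hc, he, -⟩ := exists_ray_of_mem_coneNhd hX he₁ hK hξ
    exact ⟨c, hc.trans h₁, he⟩
  · obtain ⟨c, hc, he, -⟩ := exists_ray_of_mem_coneNhd hX he₂ hK hη
    exact ⟨c, hc.trans h₂, he⟩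
  · obtain ⟨c, hc, he, hd₁⟩ := exists_ray_of_mem_coneNhd hX he₁ hK hp
    obtain ⟨c', hc', he', hd₂⟩ := exists_ray_of_mem_coneNhd hX he₂ hK hq
    filter_upwards [GeodesicRay.tendsto_pt hX he hK half,
      GeodesicRay.tendsto_pt hX he' hK half] with n hn hn'
    rw [hc, h₁] at hn
    rw [hc', h₂] at hn'
    rw [hc₁] at hd₁
    rw [hc₂] at hd₂
    have h3 := dist_triangle (hX.pt (d.1 s) (q.1 n) K) (c'.1 K) (d.1 (s - K))
    have h4 := dist_triangle (hX.pt (d.1 s) (p.1 n) K) (c.1 K) (d.1 (s + K))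
    exact hnear _ _ hn'.1 hn.1 (by linarith) (by linarith)

theorem exists_line_of_segments_near [ProperSpace X] (hX : IsCAT0 X) {p q : GeodesicRay X}
    (h0 : q.1 0 = p.1 0) {r : ℝ} (h : ∀ᶠ n : ℕ in Filter.atTop,
      ∃ u ∈ Icc (0 : ℝ) 1, dist (p.1 0) (hX.frac (q.1 n) (p.1 n) u) < r) :
    ∃ d : GeodesicLine X, d.posEnd = p.endpoint ∧ d.negEnd = q.endpoint := by
  obtain ⟨N, hN⟩ := Filter.eventually_atTop.1 h
  choose u hu hur using fun n : ℕ => hN (n + N) (Nat.le_add_left _ _)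
  have key : ∀ c : GeodesicRay X, ∀ t, 0 ≤ t → ∀ᶠ n : ℕ in Filter.atTop,
      t ≤ dist (c.1 0) (c.1 (n + N : ℕ)) ∧ dist (hX.pt (c.1 0) (c.1 (n + N : ℕ)) t) (c.1 t) ≤ 0 := by
    intro c t ht
    filter_upwards [(tendsto_natCast_atTop_atTop (R := ℝ)).eventually_ge_atTop t] with n hn
    have hn' : t ≤ (n + N : ℕ) := by push_cast; linarith [Nat.cast_nonneg (α := ℝ) N]
    have hi := c.isometricOn hX
    rw [hi.pt_ray_eq hX ht hn', dist_self, hi.dist_of_le self_mem_Ici (mem_Ici.2 (ht.trans hn'))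
      (ht.trans hn'), sub_zero]
    exact ⟨hn', le_rfl⟩
  obtain ⟨τ, hτ, h1, h2, -⟩ := hX.exists_limit_line (p.1 0) (C := 0) (fun n => q.1 (n + N : ℕ))
    (fun n => p.1 (n + N : ℕ)) u hu (fun n => (hur n).le) q.1 p.1 (by
      rw [← h0]; exact key q) (key p)
  exact ⟨⟨τ, hτ.isGeodesicOn⟩, GeodesicRay.endpoint_eq_of_dist_le h2,
    GeodesicRay.endpoint_eq_of_dist_le h1⟩

/-- By convexity `d'` is `r`-close to `d` between the two given points. There `x₁'` has a partner `d
b` with `|x d(b)| ≤ D + 2r`, and the right angle at `x₁` gives `|x₁ d(b)|² ≤ (D + 2r)² - D² = 4r(D +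
r)`. -/
theorem GeodesicLine.dist_projection_le (hX : IsCAT0 X) (d d' : GeodesicLine X) {x x₁ x₁' : X}
    {t₀ T r s₁ s₂ : ℝ} (ht₀ : d.1 t₀ = x₁) (hx₁ : d.IsProjection x x₁)
    (hx₁' : d'.IsProjection x x₁') (hr : 0 < r) (hT : 2 * dist x x₁ + 3 * r ≤ T)
    (h₁ : dist (d.1 (t₀ - T)) (d'.1 s₁) < r) (h₂ : dist (d.1 (t₀ + T)) (d'.1 s₂) < r) :
    dist x₁ x₁' ≤ r + √(4 * r * (dist x x₁ + r)) := by
  have hi := d.isometricOn hX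
  have hi' := d'.isometricOn hX
  set D := dist x x₁
  have hD0 : 0 ≤ D := dist_nonneg
  have hclose : ∀ u ∈ Icc (0 : ℝ) 1, dist (d.1 ((1 - u) * (t₀ - T) + u * (t₀ + T)))
      (d'.1 ((1 - u) * s₁ + u * s₂)) ≤ r := by
    intro u hu
    have := hX.dist_frac_frac_le (d.1 (t₀ - T)) (d.1 (t₀ + T)) (d'.1 s₁) (d'.1 s₂) hu
    rw [hi.frac_eq hX _ _ hu, hi'.frac_eq hX _ _ hu] at this
    have h3 := mul_le_mul_of_nonneg_left h₁.le (by linarith [hu.2] : 0 ≤ 1 - u)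
    have h4 := mul_le_mul_of_nonneg_left h₂.le hu.1
    linarith
  have hz := hclose (1 / 2) (by norm_num)
  rw [show (1 - 1 / 2 : ℝ) * (t₀ - T) + 1 / 2 * (t₀ + T) = t₀ by ring, ht₀] at hz
  set m := (1 - 1 / 2 : ℝ) * s₁ + 1 / 2 * s₂ with hm
  obtain ⟨⟨v, rfl⟩, hmin'⟩ := hx₁'
  have hxx : dist x (d'.1 v) ≤ D + r :=
    (hmin' _ ⟨m, rfl⟩).trans ((dist_triangle x x₁ _).trans (by linarith))
  have hvm : |v - m| ≤ 2 * D + 2 * r := by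
    rw [← hi' v trivial m trivial]
    linarith [dist_triangle_left (d'.1 v) (d'.1 m) x, dist_triangle x x₁ (d'.1 m)]
  have hss : 2 * T - 2 * r ≤ |s₁ - s₂| := by
    rw [← hi' s₁ trivial s₂ trivial]
    have h3 := hi (t₀ - T) trivial (t₀ + T) trivial
    rw [show t₀ - T - (t₀ + T) = -(2 * T) by ring, abs_neg, abs_of_nonneg (by linarith)] at h3
    have := dist_triangle4 (d.1 (t₀ - T)) (d'.1 s₁) (d'.1 s₂) (d.1 (t₀ + T))
    rw [dist_comm (d'.1 s₂)] at this
    linarith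
  -- `m` is the midpoint of `s₁` and `s₂`, and `|v - m| ≤ 2D + 2r ≤ T - r ≤ |s₁ - s₂| / 2`; this is
  -- where the bound on `T` is needed.
  obtain ⟨u, hu, rfl⟩ : ∃ u ∈ Icc (0 : ℝ) 1, (1 - u) * s₁ + u * s₂ = v := by
    have hv := abs_le.1 hvm
    rcases le_total s₁ s₂ with h | h
    · rw [abs_of_nonpos (sub_nonpos.2 h)] at hss
      have hpos : 0 < s₂ - s₁ := by linarith
      refine ⟨(v - s₁) / (s₂ - s₁), ⟨div_nonneg (by linarith) hpos.le,
        div_le_one_of_le₀ (by linarith) hpos.le⟩, ?_⟩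
      field_simp; ring
    · rw [abs_of_nonneg (sub_nonneg.2 h)] at hss
      have hpos : 0 < s₁ - s₂ := by linarith
      refine ⟨(s₁ - v) / (s₁ - s₂), ⟨div_nonneg (by linarith) hpos.le,
        div_le_one_of_le₀ (by linarith) hpos.le⟩, ?_⟩
      field_simp; ring
  have hy := hclose u hu
  set b := (1 - u) * (t₀ - T) + u * (t₀ + T)
  have hxy : dist x (d.1 b) ≤ D + 2 * r := by
    have := dist_triangle_right x (d.1 b) (d'.1 ((1 - u) * s₁ + u * s₂))
    linarith
  have hsq : dist x₁ (d.1 b) ^ 2 ≤ dist x (d.1 b) ^ 2 - D ^ 2 := by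
    apply le_of_forall_le_add_mul (C := dist x₁ (d.1 b) ^ 2)
    intro ε hε hε1
    have h3 := hX.dist_frac_sq_le x₁ (d.1 b) x (u := ε) ⟨hε.le, hε1.le⟩
    have h4 : D ≤ dist x (hX.frac x₁ (d.1 b) ε) := by
      apply hx₁.2
      rw [← ht₀, hi.frac_eq hX _ _ ⟨hε.le, hε1.le⟩]
      exact mem_range_self _
    have h5 := pow_le_pow_left₀ hD0 h4 2
    have h6 : ε * dist x₁ (d.1 b) ^ 2 ≤
        ε * (dist x (d.1 b) ^ 2 - D ^ 2 + ε * dist x₁ (d.1 b) ^ 2) := by linarith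
    exact le_of_mul_le_mul_left h6 hε
  have hfin : dist x₁ (d.1 b) ≤ √(4 * r * (D + r)) := by
    apply Real.le_sqrt_of_sq_le
    nlinarith [dist_nonneg (x := x) (y := d.1 b)]
  linarith [dist_triangle x₁ (d.1 b) (d'.1 ((1 - u) * s₁ + u * s₂))]

theorem exists_pos_add_sqrt_lt (D : ℝ) {ε : ℝ} (hε : 0 < ε) :
    ∃ r, 0 < r ∧ r + √(4 * r * (D + r)) < ε := by
  have hcont : Continuous fun r : ℝ => r + √(4 * r * (D + r)) := by fun_prop
  have hev : ∀ᶠ r : ℝ in 𝓝 0, r + √(4 * r * (D + r)) < ε := by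
    refine hcont.continuousAt.eventually_lt continuousAt_const ?_
    simpa using hε
  obtain ⟨δ, hδ, h⟩ := Metric.eventually_nhds_iff.1 hev
  refine ⟨δ / 2, by positivity, h ?_⟩
  rw [Real.dist_eq, sub_zero, abs_of_pos (by positivity)]
  linarith

end Boundary

theorem mainTheorem7 {X : Type*} [MetricSpace X] [LocallyCompactSpace X] (hX : IsCAT0 X)
    (d : GeodesicLine X) (hd : d.IsStrictlyRankOne)
    (x : X) (hx : x ∉ range d.1) (x₁ : X) (hx₁ : d.IsProjection x x₁)
    (ε : ℝ) (hε : 0 < ε) :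
    ∃ Upos ∈ 𝓝 d.posEnd, ∃ Uneg ∈ 𝓝 d.negEnd,
      (∀ ξ ∈ Upos, ∀ η ∈ Uneg, ∃ d' : GeodesicLine X, d'.posEnd = ξ ∧ d'.negEnd = η) ∧
      ∀ d' : GeodesicLine X, d'.posEnd ∈ Upos → d'.negEnd ∈ Uneg →
        ∀ x₁' : X, d'.IsProjection x x₁' → dist x₁ x₁' < ε := by
  have := hX.properSpace
  have hflat : ¬ d.BoundsFlatStrip := fun h => hd ⟨d, Relation.ReflTransGen.refl, h⟩
  obtain ⟨t₀, ht₀⟩ := hx₁.1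
  obtain ⟨r, hr, hrε⟩ := exists_pos_add_sqrt_lt (dist x x₁) hε
  set T := 2 * dist x x₁ + 3 * r
  obtain ⟨U₁, hU₁, V₁, hV₁, -, -, hnear₁⟩ := d.exists_nhds_segment_near hX hflat (t₀ - T) hr
  obtain ⟨U₂, hU₂, V₂, hV₂, hξ, hη, hnear₂⟩ := d.exists_nhds_segment_near hX hflat (t₀ + T) hr
  refine ⟨U₁ ∩ U₂, Filter.inter_mem hU₁ hU₂, V₁ ∩ V₂, Filter.inter_mem hV₁ hV₂, ?_, ?_⟩
  · intro ξ hξU η hηV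
    obtain ⟨p, hp, rfl⟩ := hξ ξ hξU.2
    obtain ⟨q, hq, rfl⟩ := hη η hηV.2
    have := hnear₂ p q hξU.2 hηV.2
    rw [← hp] at this
    exact exists_line_of_segments_near hX (hq.trans hp.symm) this
  · intro d' hpos hneg x₁' hx₁'
    have hi' := d'.isometricOn hX
    have hpt : ∀ y, (∀ᶠ n : ℕ in Filter.atTop, ∃ u ∈ Icc (0 : ℝ) 1,
        dist y (hX.frac (d'.negRay.1 n) (d'.posRay.1 n) u) < r) → ∃ s, dist y (d'.1 s) < r := by
      intro y hy
      obtain ⟨n, u, hu, h⟩ := hy.exists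
      -- The segment between points of the two halves of `d'` is part of `d'`.
      have e : hX.frac (d'.negRay.1 n) (d'.posRay.1 n) u = _ := hi'.frac_eq hX (-n) n hu
      rw [e] at h
      exact ⟨_, h⟩
    obtain ⟨s₁, hs₁⟩ := hpt _ (hnear₁ d'.posRay d'.negRay hpos.1 hneg.1)
    obtain ⟨s₂, hs₂⟩ := hpt _ (hnear₂ d'.posRay d'.negRay hpos.2 hneg.2)
    exact (d.dist_projection_le hX d' ht₀ hx₁ hx₁' hr le_rfl hs₁ hs₂).trans_lt hrε
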